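/- Let $G$ be a nondiscrete, unimodular, locally compact, second countable (Hausdorff) group with Haar measure $\lambda$, and let $\Xi$ be a standard Borel space of marks (a one-point $\Xi$ gives ordinary point processes). Let $\mathbb M$ be the space of $\Xi$-marked configurations: sets $\omega\subset G\times\Xi$ in which each $g\in G$ carries at most one mark and whose set of points is closed and discrete in $G$; we write $g\in\omega$ if $g$ is a point of $\omega$. It carries the $\sigma$-algebra generated by the counting functions of Borel sets and the left translation action of $G$. Let $\mu$ be a probability measure on $\mathbb M$ (a point process) that is $G$-invariant and ergodic and has intensity $\iota=\lambda(U)^{-1}\mathbb E_\mu|\omega\cap U|\in(0,\infty)$, where $U\subset G$ is any Borel set with $0<\lambda(U)<\infty$. Let $\mathbb M_0=\{\omega\in\mathbb M: 1\in\omega\}$ with the Palm measure $\mu_0(B)=\frac1{\iota\lambda(U)}\mathbb E_\mu\,\#\{g\in \omega\cap U: g^{-1}\omega\in B\}$. The Palm groupoid has unit space $(\mathbb M_0,\mu_0)$ and arrows $(\omega,g)$ with $\omega\in\mathbb M_0$, $g\in\omega$, with source $\omega$, target $g^{-1}\omega$, product $(\omega,g)(g^{-1}\omega,h)=(\omega,gh)$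 and arrow measure $D\mapsto\int\#\{g\in\omega:(\omega,g)\in D\}\,d\mu_0(\omega)$. The action groupoid $G\times(\mathbb M,\mu)$ has unit space $(\mathbb M,\mu)$ and arrows $(g,\omega)$ with source $\omega$, target $g^{-1}\omega$, product $(g,\omega)(h,g^{-1}\omega)=(gh,\omega)$ and arrow measure $\lambda\otimes\mu$. Then both groupoids are probability measure preserving (the unit measure is a probability measure and the arrow measure is invariant under inversion), and the following hold. 1. There is a balanced allocation: a measurable map $\mathcal A:\mathbb M\times G\to G\cup\{\bullet\}$ with $\mathcal A(h\omega,hg)=h\mathcal A(\omega,g)$ (where $h\bullet=\bullet$) and $\mathcal A(\omega,g)\in\omega$ whenever $\mathcal A(\omega,g)\ne\bullet$, such that for $\mu$-a.e. $\omega$ every $x\in\omega$ satisfies $\lambda(\{g:\mathcal A(\omega,g)=x\})=\iota^{-1}$. 2. Hence there is an extra head scheme: a measurable map $\mathcal E:\mathbb M\to G$ with $\mathcal E_\omega=\mathcal A(\omega,1)\in\omega$ for $\mu$-a.e. $\omega$, such that $E(\omega)=\mathcal E_\omega^{-1}\omega$ pushes $\mu$ forward to $\mu_0$. 3. There is a factor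 map of measured groupoids from the action groupoid $G\times(\mathbb M,\mu)$ onto the Palm groupoid: Borel maps $\varphi_0:\mathbb M\to\mathbb M_0$ on units and $\varphi$ on arrows that preserve source, target and composition, push $\mu$ forward to $\mu_0$ and $\lambda\otimes\mu$ forward to a positive finite multiple of the arrow measure of the Palm groupoid. For $\mu$-a.e. $\omega$ they satisfy $\varphi_0(\omega)=E(\omega)$ and $\varphi(g,\omega)=(E(\omega),\mathcal E_\omega^{-1}g\,\mathcal E_{g^{-1}\omega})$ for all $g\in G$. 4. Consequently cocycles lift: for every discrete group $\Gamma$ and every $\Gamma$-valued cocycle $c$ of the Palm groupoid (a measurable map on arrows with $c(ab)=c(a)c(b)$ for all composable $a,b$), $c\circ\varphi$ is a $\Gamma$-valued cocycle of the action groupoid. -/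

import Mathlib

open MeasureTheory ProbabilityTheory Set
open scoped ENNReal

namespace PointProcess

noncomputable section

/-! ## Configurations -/

/-- A `Ξ`-marked configuration in `G`: a subset of `G × Ξ` in which every point of `G` carries at
most one mark and whose set of points is closed and discrete in `G` (every compact set contains
only finitely many points). Ordinary configurations are those with a one-point mark space. -/
@[ext]
structure MarkedConfig (G Ξ : Type*) [TopologicalSpace G] where
  carrier : Set (G × Ξ)
  unique_mark : ∀ g ξ ξ', (g, ξ) ∈ carrier → (g, ξ') ∈ carrier → ξ = ξ'
  locally_finite : ∀ K : Set G, IsCompact K → (carrier ∩ Prod.fst ⁻¹' K).Finite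

variable {G Ξ : Type*} [TopologicalSpace G]

/-- The underlying set of points of a configuration. -/
def MarkedConfig.points (ω : MarkedConfig G Ξ) : Set G := Prod.fst '' ω.carrier

/-- The point counting functions of marked configurations, for `V ⊆ G × Ξ`. -/
def MarkedConfig.count (V : Set (G × Ξ)) (ω : MarkedConfig G Ξ) : ℝ≥0∞ :=
  ((ω.carrier ∩ V).encard : ℕ∞)

/-- The point counting function `N_U(ω) = |ω ∩ U|` for `U ⊆ G`. -/
def MarkedConfig.pointCount (U : Set G) (ω : MarkedConfig G Ξ) : ℝ≥0∞ :=
  ((ω.points ∩ U).encard : ℕ∞)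

/-- The σ-algebra on configurations generated by the point counting functions of Borel sets. -/
instance MarkedConfig.instMeasurableSpace [MeasurableSpace G] [MeasurableSpace Ξ] :
    MeasurableSpace (MarkedConfig G Ξ) :=
  ⨆ (V : Set (G × Ξ)) (_ : MeasurableSet V),
    MeasurableSpace.comap (MarkedConfig.count V) inferInstance

/-- Left translation `g • ω = {(g x, ξ) | (x, ξ) ∈ ω}`. -/
instance MarkedConfig.instMulAction [Group G] [IsTopologicalGroup G] :
    MulAction G (MarkedConfig G Ξ) where
  smul g ω :=
    { carrier := {p | (g⁻¹ * p.1, p.2) ∈ ω.carrier}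
      unique_mark := fun x ξ ξ' h h' => ω.unique_mark (g⁻¹ * x) ξ ξ' h h'
      locally_finite := fun K hK => by
        have h := ω.locally_finite ((fun x => g⁻¹ * x) '' K)
          (hK.image (continuous_const.mul continuous_id))
        refine (h.image (fun p : G × Ξ => (g * p.1, p.2))).subset ?_
        rintro ⟨x, ξ⟩ ⟨hx, hxK⟩
        exact ⟨(g⁻¹ * x, ξ), ⟨hx, ⟨x, hxK, rfl⟩⟩, by simp⟩ }
  one_smul ω := by
    apply MarkedConfig.ext
    ext p
    change (1⁻¹ * p.1, p.2) ∈ ω.carrier ↔ _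
    simp
  mul_smul g h ω := by
    apply MarkedConfig.ext
    ext p
    change ((g * h)⁻¹ * p.1, p.2) ∈ ω.carrier ↔ (h⁻¹ * (g⁻¹ * p.1), p.2) ∈ ω.carrier
    simp [mul_assoc]

theorem MarkedConfig.mem_smul_carrier [Group G] [IsTopologicalGroup G] (g : G)
    (ω : MarkedConfig G Ξ) (p : G × Ξ) :
    p ∈ (g • ω).carrier ↔ (g⁻¹ * p.1, p.2) ∈ ω.carrier := Iff.rfl

theorem MarkedConfig.mem_smul_points [Group G] [IsTopologicalGroup G] (g x : G)
    (ω : MarkedConfig G Ξ) : x ∈ (g • ω).points ↔ g⁻¹ * x ∈ ω.points := by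
  constructor
  · rintro ⟨p, hp, rfl⟩
    exact ⟨(g⁻¹ * p.1, p.2), hp, rfl⟩
  · rintro ⟨⟨y, ξ⟩, hp, h⟩
    refine ⟨(x, ξ), ?_, rfl⟩
    rw [mem_smul_carrier]
    simp only at h
    rwa [← h]

theorem MarkedConfig.one_mem_inv_smul [Group G] [IsTopologicalGroup G] {ω : MarkedConfig G Ξ}
    {g : G} (h : g ∈ ω.points) : (1 : G) ∈ (g⁻¹ • ω).points := by
  rw [MarkedConfig.mem_smul_points]
  simpa using h

theorem MarkedConfig.inv_mem_inv_smul [Group G] [IsTopologicalGroup G] {ω : MarkedConfig G Ξ}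
    (h : (1 : G) ∈ ω.points) (g : G) : g⁻¹ ∈ (g⁻¹ • ω).points := by
  rw [MarkedConfig.mem_smul_points]
  simpa using h

theorem MarkedConfig.mul_mem_points [Group G] [IsTopologicalGroup G] {ω : MarkedConfig G Ξ}
    {g h : G} (hh : h ∈ (g⁻¹ • ω).points) : g * h ∈ ω.points := by
  rw [MarkedConfig.mem_smul_points] at hh
  simpa using hh

theorem MarkedConfig.encard_points_inter (ω : MarkedConfig G Ξ) (S : Set G) :
    (ω.points ∩ S).encard = (ω.carrier ∩ Prod.fst ⁻¹' S).encard := by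
  have h : ω.points ∩ S = Prod.fst '' (ω.carrier ∩ Prod.fst ⁻¹' S) :=
    (Set.image_inter_preimage _ _ _).symm
  rw [h, Set.InjOn.encard_image]
  rintro ⟨x, ξ⟩ hx ⟨y, η⟩ hy (rfl : x = y)
  rw [ω.unique_mark x ξ η hx.1 hy.1]

/-! ## Measurability of counting functions and of the action -/

section Measurability

variable [MeasurableSpace G] [MeasurableSpace Ξ]

theorem MarkedConfig.measurable_count {V : Set (G × Ξ)} (hV : MeasurableSet V) :
    Measurable (MarkedConfig.count (G := G) (Ξ := Ξ) V) := by
  rw [measurable_iff_comap_le]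
  exact le_iSup₂_of_le V hV le_rfl

theorem MarkedConfig.measurable_of_count {T : Type*} [MeasurableSpace T]
    {f : T → MarkedConfig G Ξ}
    (h : ∀ V : Set (G × Ξ), MeasurableSet V → Measurable fun t => MarkedConfig.count V (f t)) :
    Measurable f := by
  rw [measurable_iff_comap_le]
  unfold MarkedConfig.instMeasurableSpace
  simp only [MeasurableSpace.comap_iSup, MeasurableSpace.comap_comp]
  exact iSup₂_le fun V hV => (measurable_iff_comap_le.1 (h V hV))

variable [BorelSpace G] [T2Space G] [SigmaCompactSpace G] [StandardBorelSpace Ξ]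

/-- Counting the points of a configuration in a measurably varying set is measurable. -/
theorem MarkedConfig.measurable_encard {T : Type*} [MeasurableSpace T]
    {f : T → MarkedConfig G Ξ} (hf : Measurable f) {W : Set (T × (G × Ξ))}
    (hW : MeasurableSet W) :
    Measurable fun t => (((f t).carrier ∩ {z | (t, z) ∈ W}).encard : ℝ≥0∞) := by
  classical
  let D : ℕ → Set (G × Ξ) := fun n => Prod.fst ⁻¹' disjointed (compactCovering G) n
  have hDm : ∀ n, MeasurableSet (D n) := fun n => measurable_fst
    (MeasurableSet.disjointed (fun i => (isCompact_compactCovering G i).measurableSet) n)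
  have hfin : ∀ (ω : MarkedConfig G Ξ) n, (ω.carrier ∩ D n).Finite := fun ω n =>
    (ω.locally_finite _ (isCompact_compactCovering G n)).subset
      (inter_subset_inter_right _ (preimage_mono (disjointed_subset _ _)))
  have happ : ∀ (ω : MarkedConfig G Ξ) n (V : Set (G × Ξ)), MeasurableSet V →
      (Measure.count.restrict (ω.carrier ∩ D n)) V = MarkedConfig.count (D n ∩ V) ω := by
    intro ω n V hV
    rw [Measure.restrict_apply hV, Measure.count_apply (hV.inter (hfin ω n).measurableSet),
      MarkedConfig.count, inter_comm V, inter_assoc]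
  let κ : ℕ → Kernel T (G × Ξ) := fun n =>
    { toFun := fun t => Measure.count.restrict ((f t).carrier ∩ D n)
      measurable' := by
        refine Measure.measurable_of_measurable_coe _ fun V hV => ?_
        simp_rw [fun t => happ (f t) n V hV]
        exact (MarkedConfig.measurable_count ((hDm n).inter hV)).comp hf }
  have hκ : ∀ n t, IsFiniteMeasure (κ n t) := fun n t => by
    refine ⟨?_⟩
    change (Measure.count.restrict ((f t).carrier ∩ D n)) univ < ∞
    rw [Measure.restrict_apply_univ]
    exact Measure.count_apply_lt_top.2 (hfin (f t) n)
  have key : (fun t => (((f t).carrier ∩ {z | (t, z) ∈ W}).encard : ℝ≥0∞)) =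
      fun t => ∑' n, κ n t (Prod.mk t ⁻¹' W) := by
    funext t
    have hWt : MeasurableSet (Prod.mk t ⁻¹' W) := measurable_prodMk_left hW
    have hun : ⋃ n, D n = univ := by
      rw [← preimage_iUnion, iUnion_disjointed, iUnion_compactCovering, preimage_univ]
    have hset : (f t).carrier ∩ {z | (t, z) ∈ W} =
        ⋃ n, ((f t).carrier ∩ D n) ∩ (Prod.mk t ⁻¹' W) := by
      rw [← iUnion_inter, ← inter_iUnion, hun, inter_univ]
      rfl
    have hm : ∀ n, MeasurableSet (((f t).carrier ∩ D n) ∩ (Prod.mk t ⁻¹' W)) := fun n =>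
      (hfin (f t) n).measurableSet.inter hWt
    rw [hset, ← Measure.count_apply (MeasurableSet.iUnion hm), measure_iUnion _ hm]
    · refine tsum_congr fun n => ?_
      change _ = (Measure.count.restrict ((f t).carrier ∩ D n)) _
      rw [Measure.restrict_apply hWt, inter_comm]
    · intro i j hij
      have := (disjoint_disjointed (compactCovering G)) hij
      refine Disjoint.mono ?_ ?_ (Disjoint.preimage Prod.fst this)
      · exact fun z hz => hz.1.2
      · exact fun z hz => hz.1.2
  rw [key]
  exact Measurable.tsum
    fun n => Kernel.measurable_kernel_prodMk_left_of_finite hW (hκ n)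

/-- Counting those points of a configuration that satisfy a measurably varying condition is
measurable. -/
theorem MarkedConfig.measurable_encard_points {T : Type*} [MeasurableSpace T]
    {f : T → MarkedConfig G Ξ} (hf : Measurable f) {W : Set (T × G)} (hW : MeasurableSet W) :
    Measurable fun t => (((f t).points ∩ {g | (t, g) ∈ W}).encard : ℝ≥0∞) := by
  have h := MarkedConfig.measurable_encard (f := f) hf
    (W := {q : T × (G × Ξ) | (q.1, q.2.1) ∈ W})
    ((measurable_fst.prodMk (measurable_fst.comp measurable_snd)) hW)
  convert h using 3 with t
  exact MarkedConfig.encard_points_inter (f t) _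

variable [Group G] [IsTopologicalGroup G] [SecondCountableTopology G]

/-- The action of `G` on configurations is jointly measurable. -/
theorem MarkedConfig.measurable_smul' {T : Type*} [MeasurableSpace T] {a : T → G}
    {f : T → MarkedConfig G Ξ} (ha : Measurable a) (hf : Measurable f) :
    Measurable fun t => a t • f t := by
  refine MarkedConfig.measurable_of_count fun V hV => ?_
  have hW : MeasurableSet {q : T × (G × Ξ) | (a q.1 * q.2.1, q.2.2) ∈ V} :=
    (((ha.comp measurable_fst).mul (measurable_fst.comp measurable_snd)).prodMk
      (measurable_snd.comp measurable_snd)) hV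
  have h := MarkedConfig.measurable_encard hf hW
  convert h using 3 with t
  have himg : (a t • f t).carrier ∩ V = (fun z : G × Ξ => (a t * z.1, z.2)) ''
      ((f t).carrier ∩ {z | (t, z) ∈ {q : T × (G × Ξ) | (a q.1 * q.2.1, q.2.2) ∈ V}}) := by
    ext ⟨x, ξ⟩
    constructor
    · rintro ⟨h1, h2⟩
      exact ⟨((a t)⁻¹ * x, ξ), ⟨h1, by simpa using h2⟩, by simp⟩
    · rintro ⟨⟨y, η⟩, ⟨h1, h2⟩, h3⟩
      simp only [Prod.mk.injEq] at h3
      obtain ⟨rfl, rfl⟩ := h3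
      refine ⟨?_, h2⟩
      rw [MarkedConfig.mem_smul_carrier]
      simpa using h1
  rw [MarkedConfig.count, himg, Function.Injective.encard_image]
  rintro ⟨x, ξ⟩ ⟨y, η⟩ hxy
  simpa using hxy

end Measurability

theorem sum_dirac_apply {I Y : Type*} [MeasurableSpace Y] (F : I → Y) {S : Set Y}
    (hS : MeasurableSet S) :
    Measure.sum (fun i => Measure.dirac (F i)) S = ((F ⁻¹' S).encard : ℝ≥0∞) := by
  rw [Measure.sum_apply _ hS]
  simp_rw [Measure.dirac_apply' _ hS]
  have h := ENNReal.tsum_one (α := F ⁻¹' S)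
  rw [tsum_subtype (F ⁻¹' S) (fun _ => (1 : ℝ≥0∞))] at h
  exact h

/-! ## Point processes, intensity and the Palm measure -/

section Processes

variable [Group G] [IsTopologicalGroup G] [MeasurableSpace G] [MeasurableSpace Ξ]

/-- `μ` is the law of an invariant and ergodic `Ξ`-marked point process on `G`. -/
structure IsErgodicInvariant (μ : Measure (MarkedConfig G Ξ)) : Prop where
  isProbabilityMeasure : IsProbabilityMeasure μ
  invariant : ∀ g : G, μ.map (fun ω => g • ω) = μ
  ergodic : ∀ S : Set (MarkedConfig G Ξ), MeasurableSet S →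
    (∀ (g : G), ∀ ω ∈ S, g • ω ∈ S) → μ S = 0 ∨ μ S = 1

/-- The intensity `𝔼_μ[N_U] / lam(U)` of a point process, computed in the window `U`; for an
invariant process it does not depend on the Borel set `U` of positive finite Haar measure. -/
def intensity (lam : Measure G) (U : Set G) (μ : Measure (MarkedConfig G Ξ)) : ℝ≥0∞ :=
  (∫⁻ ω, MarkedConfig.pointCount U ω ∂μ) / lam U

variable (G Ξ) in
/-- The space of rooted configurations: those that contain the identity of `G` as a point. -/
abbrev RootedConfig : Type _ := {ω : MarkedConfig G Ξ // (1 : G) ∈ ω.points}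

variable (G Ξ) in
/-- The space of birooted configurations `(ω, g)`, with `ω` rooted and `g` a point of `ω`. -/
abbrev BirootedConfig : Type _ := {p : RootedConfig G Ξ × G // p.2 ∈ p.1.1.points}

/-- The configuration `g⁻¹ • ω`, rooted at what was the point `g` of `ω`. -/
def reroot (ω : MarkedConfig G Ξ) (g : G) (h : g ∈ ω.points) : RootedConfig G Ξ :=
  ⟨g⁻¹ • ω, MarkedConfig.one_mem_inv_smul h⟩

/-- The measure `∑_{g ∈ ω ∩ U} δ_{g⁻¹ ω}` on rooted configurations. -/
def rerootSum (U : Set G) (ω : MarkedConfig G Ξ) : Measure (RootedConfig G Ξ) :=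
  Measure.sum fun g : {g : G // g ∈ ω.points ∩ U} => Measure.dirac (reroot ω g.1 g.2.1)

/-- The normalised Palm measure of `μ`, computed in the window `U`; see `palmMeasure_apply`. -/
def palmMeasure (lam : Measure G) (U : Set G) (μ : Measure (MarkedConfig G Ξ)) :
    Measure (RootedConfig G Ξ) :=
  (intensity lam U μ * lam U)⁻¹ • μ.bind (rerootSum U)

/-- The measure `∑_{g ∈ ω} δ_{(ω, g)}`, i.e. counting measure on the arrows with source `ω`. -/
def sourceCount (ω : RootedConfig G Ξ) : Measure (BirootedConfig G Ξ) :=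
  Measure.sum fun g : {g : G // g ∈ ω.1.points} => Measure.dirac ⟨(ω, g.1), g.2⟩

/-- The measure `D ↦ ∫ |s⁻¹(ω) ∩ D| dμ₀(ω)` on the arrows; see `palmArrowMeasure_apply`. -/
def palmArrowMeasure (lam : Measure G) (U : Set G) (μ : Measure (MarkedConfig G Ξ)) :
    Measure (BirootedConfig G Ξ) :=
  (palmMeasure lam U μ).bind sourceCount

theorem rerootSum_apply (U : Set G) (ω : MarkedConfig G Ξ) {B : Set (MarkedConfig G Ξ)}
    (hB : MeasurableSet B) :
    rerootSum U ω (Subtype.val ⁻¹' B) =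
      ((ω.points ∩ {g | g ∈ U ∧ g⁻¹ • ω ∈ B}).encard : ℝ≥0∞) := by
  rw [rerootSum, sum_dirac_apply _ (measurable_subtype_coe hB),
    ← (Subtype.val_injective (p := fun g => g ∈ ω.points ∩ U)).encard_image]
  congr 2
  ext g
  constructor
  · rintro ⟨⟨x, hx⟩, h, rfl⟩
    exact ⟨hx.1, hx.2, h⟩
  · rintro ⟨h1, h2, h3⟩
    exact ⟨⟨g, h1, h2⟩, h3, rfl⟩

theorem sourceCount_apply (ω : RootedConfig G Ξ) {D : Set (RootedConfig G Ξ × G)}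
    (hD : MeasurableSet D) :
    sourceCount ω (Subtype.val ⁻¹' D) =
      ((ω.1.points ∩ {g | (ω, g) ∈ D}).encard : ℝ≥0∞) := by
  rw [sourceCount, sum_dirac_apply _ (measurable_subtype_coe hD),
    ← (Subtype.val_injective (p := fun g => g ∈ ω.1.points)).encard_image]
  congr 2
  ext g
  constructor
  · rintro ⟨⟨x, hx⟩, h, rfl⟩
    exact ⟨hx, h⟩
  · rintro ⟨h1, h2⟩
    exact ⟨⟨g, h1⟩, h2, rfl⟩

variable [BorelSpace G] [T2Space G] [LocallyCompactSpace G] [SecondCountableTopology G]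
  [StandardBorelSpace Ξ]

theorem measurable_rerootSum {U : Set G} (hU : MeasurableSet U) :
    Measurable (rerootSum (Ξ := Ξ) U) := by
  refine Measure.measurable_of_measurable_coe _ fun S hS => ?_
  obtain ⟨B, hB, rfl⟩ := hS
  simp_rw [fun ω => rerootSum_apply U ω hB]
  refine MarkedConfig.measurable_encard_points (f := fun ω : MarkedConfig G Ξ => ω) measurable_id
    (W := {q : MarkedConfig G Ξ × G | q.2 ∈ U ∧ q.2⁻¹ • q.1 ∈ B}) ?_
  exact (measurable_snd hU).inter
    ((MarkedConfig.measurable_smul' measurable_snd.inv measurable_fst) hB)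

/-- The defining formula of the Palm measure,
`μ₀(B) = (intensity · lam(U))⁻¹ 𝔼_μ #{g ∈ ω ∩ U | g⁻¹ ω ∈ B}`. -/
theorem palmMeasure_apply (lam : Measure G) {U : Set G} (hU : MeasurableSet U)
    (μ : Measure (MarkedConfig G Ξ)) {B : Set (MarkedConfig G Ξ)} (hB : MeasurableSet B) :
    palmMeasure lam U μ (Subtype.val ⁻¹' B) = (intensity lam U μ * lam U)⁻¹ *
      ∫⁻ ω, ((ω.points ∩ {g | g ∈ U ∧ g⁻¹ • ω ∈ B}).encard : ℝ≥0∞) ∂μ := by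
  rw [palmMeasure, Measure.smul_apply, smul_eq_mul,
    Measure.bind_apply (measurable_subtype_coe hB) (measurable_rerootSum hU).aemeasurable]
  simp_rw [fun ω => rerootSum_apply U ω hB]

theorem measurable_sourceCount : Measurable (sourceCount (G := G) (Ξ := Ξ)) := by
  refine Measure.measurable_of_measurable_coe _ fun S hS => ?_
  obtain ⟨D, hD, rfl⟩ := hS
  simp_rw [fun ω => sourceCount_apply ω hD]
  exact MarkedConfig.measurable_encard_points (f := fun ω : RootedConfig G Ξ => ω.1)
    measurable_subtype_coe hD

theorem palmArrowMeasure_apply (lam : Measure G) (U : Set G) (μ : Measure (MarkedConfig G Ξ))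
    {D : Set (RootedConfig G Ξ × G)} (hD : MeasurableSet D) :
    palmArrowMeasure lam U μ (Subtype.val ⁻¹' D) =
      ∫⁻ ω, ((ω.1.points ∩ {g | (ω, g) ∈ D}).encard : ℝ≥0∞) ∂(palmMeasure lam U μ) := by
  rw [palmArrowMeasure,
    Measure.bind_apply (measurable_subtype_coe hD) measurable_sourceCount.aemeasurable]
  simp_rw [fun ω => sourceCount_apply ω hD]

end Processes

/-! ## Measured groupoids -/

/-- A Borel groupoid with unit space `X` and arrow space `A`, with a measure on its units and one
on its arrows. The product `comp a b` is defined when the target of `a` is the source of `b`. -/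
structure MeasuredGroupoid (X A : Type*) [MeasurableSpace X] [MeasurableSpace A] where
  src : A → X
  tgt : A → X
  one : X → A
  inv : A → A
  comp : ∀ a b : A, tgt a = src b → A
  src_one : ∀ x, src (one x) = x
  tgt_one : ∀ x, tgt (one x) = x
  src_inv : ∀ a, src (inv a) = tgt a
  tgt_inv : ∀ a, tgt (inv a) = src a
  src_comp : ∀ a b h, src (comp a b h) = src a
  tgt_comp : ∀ a b h, tgt (comp a b h) = tgt b
  one_comp : ∀ a h, comp (one (src a)) a h = a
  comp_one : ∀ a h, comp a (one (tgt a)) h = a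
  comp_inv : ∀ a h, comp a (inv a) h = one (src a)
  inv_comp : ∀ a h, comp (inv a) a h = one (tgt a)
  comp_assoc : ∀ a b c (hab : tgt a = src b) (hbc : tgt b = src c)
    (h : tgt (comp a b hab) = src c) (h' : tgt a = src (comp b c hbc)),
    comp (comp a b hab) c h = comp a (comp b c hbc) h'
  measurable_src : Measurable src
  measurable_tgt : Measurable tgt
  measurable_one : Measurable one
  measurable_inv : Measurable inv
  measurable_comp : Measurable fun p : {p : A × A // tgt p.1 = src p.2} => comp p.1.1 p.1.2 p.2
  unitMeasure : Measure X
  arrowMeasure : Measure A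

namespace MeasuredGroupoid

variable {X A Y B : Type*} [MeasurableSpace X] [MeasurableSpace A] [MeasurableSpace Y]
  [MeasurableSpace B]

/-- The groupoid is probability measure preserving: the measure on the units is a probability
measure and the measure on the arrows is invariant under inversion (so that the measures obtained
from the source map and from the target map coincide). -/
def IsPMP (𝒢 : MeasuredGroupoid X A) : Prop :=
  IsProbabilityMeasure 𝒢.unitMeasure ∧ 𝒢.arrowMeasure.map 𝒢.inv = 𝒢.arrowMeasure

/-- A factor map of measured groupoids: a pair of Borel maps `φ₀` on units and `φ` on arrows which
preserve source, target and composition, push the measure on the units to the measure on the units,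
and push the measure on the arrows to a positive finite multiple of the measure on the arrows
(for the action groupoid of `G` this measure involves the choice of a Haar measure). -/
structure IsFactorMap (𝒢 : MeasuredGroupoid X A) (ℋ : MeasuredGroupoid Y B)
    (φ₀ : X → Y) (φ : A → B) : Prop where
  measurable_unit : Measurable φ₀
  measurable_arrow : Measurable φ
  map_src : ∀ a, ℋ.src (φ a) = φ₀ (𝒢.src a)
  map_tgt : ∀ a, ℋ.tgt (φ a) = φ₀ (𝒢.tgt a)
  map_comp : ∀ a b (h : 𝒢.tgt a = 𝒢.src b) (h' : ℋ.tgt (φ a) = ℋ.src (φ b)),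
    φ (𝒢.comp a b h) = ℋ.comp (φ a) (φ b) h'
  map_unitMeasure : 𝒢.unitMeasure.map φ₀ = ℋ.unitMeasure
  map_arrowMeasure : ∃ c : ℝ≥0∞, c ≠ 0 ∧ c ≠ ∞ ∧
    𝒢.arrowMeasure.map φ = c • ℋ.arrowMeasure

/-- A `Γ`-valued cocycle of a groupoid. -/
structure IsCocycle {Γ : Type*} [Group Γ] [MeasurableSpace Γ] (𝒢 : MeasuredGroupoid X A)
    (c : A → Γ) : Prop where
  measurable : Measurable c
  map_comp : ∀ a b (h : 𝒢.tgt a = 𝒢.src b), c (𝒢.comp a b h) = c a * c b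

end MeasuredGroupoid

section Groupoids

variable [Group G] [IsTopologicalGroup G] [MeasurableSpace G] [MeasurableSpace Ξ]
  [BorelSpace G] [T2Space G] [LocallyCompactSpace G] [SecondCountableTopology G]
  [StandardBorelSpace Ξ]

/-- The action groupoid `G × (𝕄, μ)`: the arrow `(g, ω)` has source `ω` and target `g⁻¹ ω`, and
`(g, ω) · (h, g⁻¹ ω) = (g h, ω)`. -/
def actionGroupoid (lam : Measure G) (μ : Measure (MarkedConfig G Ξ)) :
    MeasuredGroupoid (MarkedConfig G Ξ) (G × MarkedConfig G Ξ) where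
  src a := a.2
  tgt a := a.1⁻¹ • a.2
  one ω := (1, ω)
  inv a := (a.1⁻¹, a.1⁻¹ • a.2)
  comp a b _ := (a.1 * b.1, a.2)
  src_one _ := rfl
  tgt_one ω := by simp
  src_inv _ := rfl
  tgt_inv a := by simp
  src_comp _ _ _ := rfl
  tgt_comp a b h := by
    simp only [mul_inv_rev, mul_smul]
    rw [h]
  one_comp a _ := by simp
  comp_one a _ := by simp
  comp_inv a _ := by simp
  inv_comp a _ := by simp
  comp_assoc a b c _ _ _ _ := by simp [mul_assoc]
  measurable_src := measurable_snd
  measurable_tgt := MarkedConfig.measurable_smul' measurable_fst.inv measurable_snd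
  measurable_one := measurable_const.prodMk measurable_id
  measurable_inv := measurable_fst.inv.prodMk
    (MarkedConfig.measurable_smul' measurable_fst.inv measurable_snd)
  measurable_comp :=
    ((measurable_fst.comp (measurable_fst.comp measurable_subtype_coe)).mul
      (measurable_fst.comp (measurable_snd.comp measurable_subtype_coe))).prodMk
      (measurable_snd.comp (measurable_fst.comp measurable_subtype_coe))
  unitMeasure := μ
  arrowMeasure := lam.prod μ

/-- The Palm groupoid of `μ`, i.e. the rerooting groupoid with the Palm measure: the arrow `(ω, g)`
has source `ω` and target `g⁻¹ ω`, and `(ω, g) · (g⁻¹ ω, h) = (ω, g h)`. -/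
def palmGroupoid (lam : Measure G) (U : Set G) (μ : Measure (MarkedConfig G Ξ)) :
    MeasuredGroupoid (RootedConfig G Ξ) (BirootedConfig G Ξ) where
  src a := a.1.1
  tgt a := reroot a.1.1.1 a.1.2 a.2
  one ω := ⟨(ω, 1), ω.2⟩
  inv a := ⟨(reroot a.1.1.1 a.1.2 a.2, a.1.2⁻¹), MarkedConfig.inv_mem_inv_smul a.1.1.2 a.1.2⟩
  comp a b h := ⟨(a.1.1, a.1.2 * b.1.2), MarkedConfig.mul_mem_points
    (congrArg (fun ω : RootedConfig G Ξ => b.1.2 ∈ ω.1.points) h ▸ b.2)⟩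
  src_one _ := rfl
  tgt_one ω := Subtype.ext (by simp [reroot])
  src_inv _ := rfl
  tgt_inv a := Subtype.ext (by simp [reroot])
  src_comp _ _ _ := rfl
  tgt_comp a b h := by
    apply Subtype.ext
    have h' : a.1.2⁻¹ • a.1.1.1 = b.1.1.1 := congrArg Subtype.val h
    simp only [reroot, mul_inv_rev, mul_smul]
    rw [h']
  one_comp a _ := by simp
  comp_one a _ := by simp
  comp_inv a _ := by simp
  inv_comp a _ := by simp
  comp_assoc a b c _ _ _ _ := by simp [mul_assoc]
  measurable_src := measurable_fst.comp measurable_subtype_coe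
  measurable_tgt := Measurable.subtype_mk (MarkedConfig.measurable_smul'
    (measurable_snd.comp measurable_subtype_coe).inv
    (measurable_subtype_coe.comp (measurable_fst.comp measurable_subtype_coe)))
  measurable_one := Measurable.subtype_mk (measurable_id.prodMk measurable_const)
  measurable_inv := Measurable.subtype_mk (Measurable.prodMk
    (Measurable.subtype_mk (MarkedConfig.measurable_smul'
      (measurable_snd.comp measurable_subtype_coe).inv
      (measurable_subtype_coe.comp (measurable_fst.comp measurable_subtype_coe))))
    (measurable_snd.comp measurable_subtype_coe).inv)
  measurable_comp := Measurable.subtype_mk (Measurable.prodMk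
    (measurable_fst.comp (measurable_subtype_coe.comp
      (measurable_fst.comp measurable_subtype_coe)))
    ((measurable_snd.comp (measurable_subtype_coe.comp
      (measurable_fst.comp measurable_subtype_coe))).mul
      (measurable_snd.comp (measurable_subtype_coe.comp
      (measurable_snd.comp measurable_subtype_coe)))))
  unitMeasure := palmMeasure lam U μ
  arrowMeasure := palmArrowMeasure lam U μ

end Groupoids

/-! ## Allocations and extra head schemes -/

section Allocations

variable [Group G] [IsTopologicalGroup G] [MeasurableSpace G] [MeasurableSpace Ξ]

/-- A partial allocation: a measurable equivariant map `𝕄 × G → G ∪ {•}`, with `•` written `none`,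
that assigns to `g` either a point of the configuration or nothing. -/
structure IsPartialAllocation (𝒜 : MarkedConfig G Ξ → G → Option G) : Prop where
  measurable : ∀ S : Set G, MeasurableSet S →
    MeasurableSet {p : MarkedConfig G Ξ × G | ∃ x ∈ S, 𝒜 p.1 p.2 = some x}
  equivariant : ∀ (h : G) (ω : MarkedConfig G Ξ) (g : G),
    𝒜 (h • ω) (h * g) = (𝒜 ω g).map fun x => h * x
  mem_points : ∀ (ω : MarkedConfig G Ξ) (g x : G), 𝒜 ω g = some x → x ∈ ω.points

/-- The cell `{g | 𝒜(ω, g) = x}` of land allocated to `x`. -/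
def cell (𝒜 : MarkedConfig G Ξ → G → Option G) (ω : MarkedConfig G Ξ) (x : G) : Set G :=
  {g | 𝒜 ω g = some x}

/-- A balanced allocation for `μ`: almost surely every point of the process is allocated land of
Haar measure `intensity⁻¹`. -/
structure IsBalancedAllocation (lam : Measure G) (U : Set G) (μ : Measure (MarkedConfig G Ξ))
    (𝒜 : MarkedConfig G Ξ → G → Option G) : Prop where
  isPartialAllocation : IsPartialAllocation 𝒜
  balanced : ∀ᵐ ω ∂μ, ∀ x ∈ ω.points, lam (cell 𝒜 ω x) = (intensity lam U μ)⁻¹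

/-- An extra head scheme for `μ`: a measurable map `ℰ` from configurations to `G` such that
`ℰ(ω)` is almost surely a point of `ω` and `ℰ(ω)⁻¹ ω` is distributed as the Palm measure. -/
structure IsExtraHeadScheme (lam : Measure G) (U : Set G) (μ : Measure (MarkedConfig G Ξ))
    (ℰ : MarkedConfig G Ξ → G) : Prop where
  measurable : Measurable ℰ
  mem_points : ∀ᵐ ω ∂μ, ℰ ω ∈ ω.points
  map_eq : μ.map (fun ω => (ℰ ω)⁻¹ • ω) = (palmMeasure lam U μ).map Subtype.val

end Allocations

end

end PointProcess

namespace PointProcess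

open Filter Topology

set_option linter.unusedSectionVars false

/-! ## Measure-theoretic preliminaries -/

/-! Write c for the inverse of the intensity. A site g of ω is allocated to x when a fixed relation
A holds between g⁻¹ω and g⁻¹x. Equivariance is then automatic, and an allocation amounts to a choice
of the point that owns the identity. Everything follows from a measurable choice ℰ under which
almost surely every point owns land of Haar measure c.

Existence is greedy. Countably many windows isolate every point of every configuration. For each
window in turn, a point takes unallocated sites that see it as the only point in that window, until
it owns c or these sites run out; as Haar measure has no atoms, the quota can be met exactly. In the
limit no configuration has both an unallocated site and a point owning less than c
(`exists_greedy_section`).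

The mass transport principle `mass_transport` says that the points in U own on average λ(U) times
the probability that the identity is allocated. By ergodicity, unsaturated points exist with
probability 0 or 1. If the probability is 1, the identity is almost surely allocated, so the points
in U own λ(U) on average. This is the largest amount their quotas permit, so they are saturated
after all, a contradiction. Hence all points are saturated, and mass transport, read backwards,
shows that the identity is almost surely allocated (`exists_balanced_section`).

For a balanced choice ℰ, mass transport applied to the event that the configuration seen from its
head lies in B is the Palm formula (`measure_head_smul_mem`). For fixed ω, the arrow (g, ω) goes to
the arrow from the head of ω to the owner of g. Each owner has a cell of measure c, so Haar measure
is pushed to c times counting measure (`map_headArrow`). Inversion invariance of the Palm groupoid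
is inherited from the action groupoid. -/

/-- A Haar measure that is also right invariant is invariant under inversion. -/
theorem isInvInvariant_of_isMulRightInvariant {G : Type*} [Group G] [TopologicalSpace G]
    [IsTopologicalGroup G] [LocallyCompactSpace G] [SecondCountableTopology G]
    [MeasurableSpace G] [BorelSpace G] (lam : Measure G) [lam.IsHaarMeasure]
    [lam.IsMulRightInvariant] : lam.IsInvInvariant := by
  -- Right invariance of `lam` is left invariance of `lam.inv`, so uniqueness of Haar measure
  -- applies. A symmetric set of positive finite measure then forces the factor to be 1.
  have hc := Measure.isMulLeftInvariant_eq_smul lam.inv lam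
  set c := Measure.haarScalarFactor lam.inv lam
  obtain ⟨K, hK, hK1⟩ := exists_compact_mem_nhds (1 : G)
  have hsym : lam.inv (K ∪ K⁻¹) = lam (K ∪ K⁻¹) := by
    rw [Measure.inv_apply, union_inv, inv_inv, union_comm]
  have hpos : lam (K ∪ K⁻¹) ≠ 0 :=
    (Measure.measure_pos_of_mem_nhds lam (mem_of_superset hK1 subset_union_left)).ne'
  have hfin : lam (K ∪ K⁻¹) ≠ ∞ := (hK.union hK.inv).measure_ne_top
  rw [hc, Measure.smul_apply, ENNReal.smul_def, smul_eq_mul] at hsym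
  have h1 : (c : ℝ≥0∞) = 1 := by
    rw [← ENNReal.mul_left_inj hpos hfin, hsym, one_mul]
  refine ⟨?_⟩
  have h2 : c = 1 := by exact_mod_cast h1
  rw [hc, h2, one_smul]

/-- For an atomless finite measure `m` on the line, the points at which the distribution function
is at most `c` have total measure `min (m univ) c`. -/
theorem measure_setOf_measure_Iic_le (m : Measure ℝ) [IsFiniteMeasure m] [NullSingletonClass m]
    (c : ℝ≥0∞) : m {y | m (Iic y) ≤ c} = min (m univ) c := by
  set L : Set ℝ := {y | m (Iic y) ≤ c}
  have hLlow : ∀ y ∈ L, ∀ z ≤ y, z ∈ L := fun y hy z hz =>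
    (measure_mono (Iic_subset_Iic.2 hz)).trans hy
  have hle : m L ≤ c := by
    -- A countable cofinal subset: the maximum of `L` if there is one, otherwise its rational
    -- points. It exhibits `L` as a countable directed union of half-lines of measure at most `c`.
    obtain ⟨T, hTL, hTc, hT⟩ : ∃ T ⊆ L, T.Countable ∧ ∀ y ∈ L, ∃ z ∈ T, y ≤ z := by
      by_cases hmax : ∃ z ∈ L, ∀ y ∈ L, y ≤ z
      · obtain ⟨z, hz, h⟩ := hmax
        exact ⟨{z}, by simpa using hz, countable_singleton z, fun y hy => ⟨z, rfl, h y hy⟩⟩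
      · push Not at hmax
        refine ⟨L ∩ range ((↑) : ℚ → ℝ), inter_subset_left,
          (countable_range _).mono inter_subset_right, fun y hy => ?_⟩
        obtain ⟨w, hw, hyw⟩ := hmax y hy
        obtain ⟨q, h1, h2⟩ := exists_rat_btwn hyw
        exact ⟨q, ⟨hLlow w hw q h2.le, q, rfl⟩, h1.le⟩
    have hsub : L ⊆ ⋃ z ∈ T, Iic z := fun y hy => by
      obtain ⟨z, hz, h⟩ := hT y hy
      exact mem_biUnion hz h
    refine (measure_mono hsub).trans ?_
    rw [measure_biUnion_eq_iSup hTc]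
    · exact iSup₂_le fun y hy => hTL hy
    · intro y hy z hz
      rcases le_total y z with h | h
      · exact ⟨z, hz, Iic_subset_Iic.2 h, subset_rfl⟩
      · exact ⟨y, hy, subset_rfl, Iic_subset_Iic.2 h⟩
  refine le_antisymm (le_min (measure_mono (subset_univ _)) hle) ?_
  by_cases hL : L = univ
  · rw [hL]; exact min_le_left _ _
  refine (min_le_right _ _).trans ?_
  obtain ⟨b, hb⟩ := (ne_univ_iff_exists_notMem L).1 hL
  -- `L` contains the open half-line below the infimum `a` of its complement, and continuity from
  -- above bounds the mass of the closed half-line from below by `c`.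
  by_cases hbdd : BddBelow Lᶜ
  · set a := sInf Lᶜ
    have h1 : Iio a ⊆ L := fun y hy => by
      by_contra h
      exact absurd (csInf_le hbdd h) (not_le.2 hy)
    have h2 : ∀ y, a < y → c ≤ m (Iic y) := fun y hy => by
      obtain ⟨z, hz, hzy⟩ := exists_lt_of_csInf_lt ⟨b, hb⟩ hy
      by_contra hc
      exact hz (hLlow y (not_le.1 hc).le z hzy.le)
    have h3 : c ≤ m (Iic a) := by
      have hlim : Tendsto (fun n : ℕ => m (Iic (a + 1 / (n + 1)))) atTop
          (𝓝 (m (⋂ n : ℕ, Iic (a + 1 / ((n : ℝ) + 1))))) := by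
        refine tendsto_measure_iInter_atTop (fun n => measurableSet_Iic.nullMeasurableSet) ?_
          ⟨0, measure_ne_top _ _⟩
        intro i j hij
        refine Iic_subset_Iic.2 ?_
        have := Nat.one_div_le_one_div (α := ℝ) hij
        linarith
      have hset : (⋂ n : ℕ, Iic (a + 1 / ((n : ℝ) + 1))) = Iic a := by
        ext y
        simp only [mem_iInter, mem_Iic]
        constructor
        · intro h
          have := tendsto_one_div_add_atTop_nhds_zero_nat (𝕜 := ℝ)
          have h' := this.const_add a
          rw [add_zero] at h'
          exact ge_of_tendsto' h' h
        · intro h n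
          have : (0 : ℝ) ≤ 1 / ((n : ℝ) + 1) := by positivity
          linarith
      rw [hset] at hlim
      refine ge_of_tendsto' hlim fun n => h2 _ ?_
      have : (0 : ℝ) < 1 / ((n : ℝ) + 1) := by positivity
      linarith
    -- The endpoint may be missing from `L`; without atoms it carries no mass.
    rw [← measure_congr (Iio_ae_eq_Iic (μ := m) (a := a))] at h3
    exact h3.trans (measure_mono h1)
  -- Here all half-lines have measure at least `c` while they shrink to the empty set, so `c = 0`.
  · have hall : ∀ y, c ≤ m (Iic y) := fun y => by
      rw [not_bddBelow_iff] at hbdd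
      obtain ⟨z, hz, hzy⟩ := hbdd y
      by_contra hc
      exact hz (hLlow y (not_le.1 hc).le z hzy.le)
    have hlim : Tendsto (fun n : ℕ => m (Iic (-(n : ℝ)))) atTop
        (𝓝 (m (⋂ n : ℕ, Iic (-(n : ℝ))))) := by
      refine tendsto_measure_iInter_atTop (fun n => measurableSet_Iic.nullMeasurableSet) ?_
          ⟨0, measure_ne_top _ _⟩
      intro i j hij
      refine Iic_subset_Iic.2 (neg_le_neg ?_)
      exact_mod_cast hij
    have hset : (⋂ n : ℕ, Iic (-(n : ℝ))) = ∅ := by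
      ext y
      simp only [mem_iInter, mem_Iic, mem_empty_iff_false, iff_false, not_forall, not_le]
      obtain ⟨n, hn⟩ := exists_nat_gt (-y)
      exact ⟨n, by linarith⟩
    rw [hset, measure_empty] at hlim
    exact (ge_of_tendsto' hlim fun n => hall _).trans zero_le

/-- A set `S` of finite measure can be cut down to measure `c` along the sublevel sets of an
injective function. -/
theorem measure_inter_setOf_le {Y : Type*} [MeasurableSpace Y] (ν : Measure Y)
    [NullSingletonClass ν] {t : Y → ℝ} (ht : Measurable t) (hinj : Function.Injective t) {S : Set Y}
    (hS : ν S ≠ ∞) (c : ℝ≥0∞) :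
    ν (S ∩ {y | ν (S ∩ {z | t z ≤ t y}) ≤ c}) = min (ν S) c := by
  have hfin : IsFiniteMeasure ((ν.restrict S).map t) := by
    refine ⟨?_⟩
    rw [Measure.map_apply ht MeasurableSet.univ]
    simpa using hS.lt_top
  have hat : NullSingletonClass ((ν.restrict S).map t) := by
    refine ⟨fun x => ?_⟩
    rw [Measure.map_apply ht (measurableSet_singleton x)]
    exact ((subsingleton_singleton (a := x)).preimage hinj).measure_zero _
  have hIic : ∀ r, (ν.restrict S).map t (Iic r) = ν (S ∩ {z | t z ≤ r}) := fun r => by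
    rw [Measure.map_apply ht measurableSet_Iic,
      Measure.restrict_apply (ht measurableSet_Iic), inter_comm]
    rfl
  have hL : MeasurableSet {r | (ν.restrict S).map t (Iic r) ≤ c} := by
    have hmono : Monotone fun r => (ν.restrict S).map t (Iic r) := fun a b hab =>
      measure_mono (Iic_subset_Iic.2 hab)
    exact hmono.measurable measurableSet_Iic
  have h := measure_setOf_measure_Iic_le ((ν.restrict S).map t) c
  rw [Measure.map_apply ht hL, Measure.restrict_apply (ht hL),
    Measure.map_apply ht MeasurableSet.univ, inter_comm] at h
  simpa [hIic] using h

/-- The expected number of points of a countable set that lie in a random set. -/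
theorem lintegral_encard_inter {Y Z : Type*} [MeasurableSpace Y] [MeasurableSpace Z]
    [MeasurableSingletonClass Z]
    (ν : Measure Y) {P : Set Z} (hP : P.Countable) {W : Set (Y × Z)} (hW : MeasurableSet W) :
    ∫⁻ y, ((P ∩ {z | (y, z) ∈ W}).encard : ℝ≥0∞) ∂ν = ∑' z : P, ν {y | (y, z.1) ∈ W} := by
  have : Countable P := hP.to_subtype
  have hm : ∀ z : Z, MeasurableSet {y | (y, z) ∈ W} := fun z => measurable_prodMk_right hW
  have h1 : ∀ y, ((P ∩ {z | (y, z) ∈ W}).encard : ℝ≥0∞) =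
      ∑' z : P, {y | (y, z.1) ∈ W}.indicator (fun _ => (1 : ℝ≥0∞)) y := fun y => by
    have h := ENNReal.tsum_one (α := ↥(P ∩ {z | (y, z) ∈ W}))
    change _ = ((P ∩ {z | (y, z) ∈ W}).encard : ℝ≥0∞) at h
    rw [← h, tsum_subtype (P ∩ {z | (y, z) ∈ W}) (fun _ => (1 : ℝ≥0∞)),
      tsum_subtype P (fun z => {y | (y, z) ∈ W}.indicator (fun _ => (1 : ℝ≥0∞)) y)]
    refine tsum_congr fun z => ?_
    by_cases hz : z ∈ P <;> by_cases hw : (y, z) ∈ W <;> simp [hz, hw]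
  simp_rw [h1]
  rw [lintegral_tsum fun z : P => (measurable_const.indicator (hm z.1)).aemeasurable]
  refine tsum_congr fun z => ?_
  rw [lintegral_indicator (hm z.1)]
  simp

section Transport

variable {G Ξ : Type*} [Group G] [TopologicalSpace G] [IsTopologicalGroup G] [T2Space G]
  [LocallyCompactSpace G] [SecondCountableTopology G] [MeasurableSpace G] [BorelSpace G]
  [MeasurableSpace Ξ] [StandardBorelSpace Ξ]

/-! ## Measurability of relations between configurations and points -/

theorem MarkedConfig.countable_points (ω : MarkedConfig G Ξ) : ω.points.Countable := by
  have h : ω.points = ⋃ n, ω.points ∩ compactCovering G n := by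
    rw [← inter_iUnion, iUnion_compactCovering, inter_univ]
  rw [h]
  refine countable_iUnion fun n => Finite.countable ?_
  rw [← encard_lt_top_iff, ω.encard_points_inter, encard_lt_top_iff]
  exact ω.locally_finite _ (isCompact_compactCovering G n)

theorem measurable_encard_fiber {A : Set (MarkedConfig G Ξ × G)} (hA : MeasurableSet A) :
    Measurable fun ω : MarkedConfig G Ξ => ((ω.points ∩ {x | (ω, x) ∈ A}).encard : ℝ≥0∞) :=
  MarkedConfig.measurable_encard_points measurable_id hA

/-- Existence of a point means that a measurable count is nonzero. Projections along the points of a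
configuration therefore preserve measurability, unlike general projections. -/
theorem measurableSet_exists_mem_points {T : Type*} [MeasurableSpace T]
    {f : T → MarkedConfig G Ξ} (hf : Measurable f) {W : Set (T × G)} (hW : MeasurableSet W) :
    MeasurableSet {t | ∃ x ∈ (f t).points, (t, x) ∈ W} := by
  convert (MarkedConfig.measurable_encard_points hf hW) (measurableSet_singleton 0).compl using 1
  ext t
  simp [Set.eq_empty_iff_forall_notMem]

theorem measurableSet_mem_points :
    MeasurableSet {p : MarkedConfig G Ξ × G | p.2 ∈ p.1.points} := by
  convert measurableSet_exists_mem_points (T := MarkedConfig G Ξ × G) (f := Prod.fst)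
    measurable_fst (W := {q | q.2 = q.1.2})
    (measurableSet_eq_fun measurable_snd (measurable_snd.comp measurable_fst)) using 1
  ext p
  simp

theorem measurableSet_points_nonempty :
    MeasurableSet {ω : MarkedConfig G Ξ | ω.points.Nonempty} := by
  convert measurableSet_exists_mem_points (f := fun ω : MarkedConfig G Ξ => ω) measurable_id
    MeasurableSet.univ using 1
  ext ω
  simp [Set.Nonempty]

theorem points_smul_nonempty_iff (g : G) (ω : MarkedConfig G Ξ) :
    (g • ω).points.Nonempty ↔ ω.points.Nonempty := by
  constructor
  · rintro ⟨x, hx⟩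
    exact ⟨_, (MarkedConfig.mem_smul_points g x ω).1 hx⟩
  · rintro ⟨x, hx⟩
    exact ⟨g * x, (MarkedConfig.mem_smul_points g _ ω).2 (by simpa using hx)⟩

/-! ## Sections and the land they allocate -/

/-- A measurable relation that assigns to a configuration at most one of its points. -/
structure IsSection (A : Set (MarkedConfig G Ξ × G)) : Prop where
  measurableSet : MeasurableSet A
  mem_points : ∀ ω x, (ω, x) ∈ A → x ∈ ω.points
  unique : ∀ ω x y, (ω, x) ∈ A → (ω, y) ∈ A → x = y

/-- The configurations to which a relation assigns some point. -/
def domain (A : Set (MarkedConfig G Ξ × G)) : Set (MarkedConfig G Ξ) := {ω | ∃ x, (ω, x) ∈ A}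

/-- The Haar measure of the set of sites from which the point `x` of `ω` is seen as related. -/
noncomputable def land (lam : Measure G) (A : Set (MarkedConfig G Ξ × G)) (ω : MarkedConfig G Ξ)
    (x : G) : ℝ≥0∞ :=
  lam {g | (g⁻¹ • ω, g⁻¹ * x) ∈ A}

theorem IsSection.measurableSet_domain {A : Set (MarkedConfig G Ξ × G)} (hA : IsSection A) :
    MeasurableSet (domain A) := by
  convert measurableSet_exists_mem_points (f := fun ω : MarkedConfig G Ξ => ω) measurable_id
    hA.measurableSet using 1
  ext ω
  exact ⟨fun ⟨x, hx⟩ => ⟨x, hA.mem_points ω x hx, hx⟩, fun ⟨x, _, hx⟩ => ⟨x, hx⟩⟩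

theorem measurable_shift : Measurable fun q : (MarkedConfig G Ξ × G) × G =>
    (q.2⁻¹ • q.1.1, q.2⁻¹ * q.1.2) :=
  (MarkedConfig.measurable_smul' measurable_snd.inv (measurable_fst.comp measurable_fst)).prodMk
    (measurable_snd.inv.mul (measurable_snd.comp measurable_fst))

theorem measurableSet_shift {A : Set (MarkedConfig G Ξ × G)} (hA : MeasurableSet A)
    (ω : MarkedConfig G Ξ) (x : G) : MeasurableSet {g : G | (g⁻¹ • ω, g⁻¹ * x) ∈ A} :=
  (measurable_shift.comp (measurable_prodMk_left (x := (ω, x)))) hA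

theorem measurable_land (lam : Measure G) [SFinite lam] {A : Set (MarkedConfig G Ξ × G)}
    (hA : MeasurableSet A) :
    Measurable fun p : MarkedConfig G Ξ × G => land lam A p.1 p.2 :=
  measurable_measure_prodMk_left (measurable_shift hA)

theorem land_smul (lam : Measure G) [lam.IsMulLeftInvariant] (A : Set (MarkedConfig G Ξ × G))
    (h : G) (ω : MarkedConfig G Ξ) (x : G) : land lam A (h • ω) (h * x) = land lam A ω x := by
  have hset : {g | (g⁻¹ • h • ω, g⁻¹ * (h * x)) ∈ A} =
      (fun g => h⁻¹ * g) ⁻¹' {g | (g⁻¹ • ω, g⁻¹ * x) ∈ A} := by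
    ext g
    simp [mul_smul, mul_assoc]
  rw [land, hset, measure_preimage_mul, land]

/-! ## The mass transport principle -/

theorem IsErgodicInvariant.lintegral_smul {μ : Measure (MarkedConfig G Ξ)}
    (hμ : IsErgodicInvariant μ) (g : G) {f : MarkedConfig G Ξ → ℝ≥0∞} (hf : Measurable f) :
    ∫⁻ ω, f (g • ω) ∂μ = ∫⁻ ω, f ω ∂μ := by
  conv_rhs => rw [← hμ.invariant g]
  exact (lintegral_map hf (MarkedConfig.measurable_smul' measurable_const measurable_id)).symm

theorem IsErgodicInvariant.measure_setOf_smul {μ : Measure (MarkedConfig G Ξ)}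
    (hμ : IsErgodicInvariant μ) (g : G) {S : Set (MarkedConfig G Ξ)} (hS : MeasurableSet S) :
    μ {ω | g • ω ∈ S} = μ S := by
  conv_rhs => rw [← hμ.invariant g]
  exact (Measure.map_apply
    (MarkedConfig.measurable_smul' measurable_const measurable_id) hS).symm

/-- The mass transport principle: the land allocated to the points of `U` is, on average, the
measure of `U` times the number of points related to the configuration. -/
theorem mass_transport (lam : Measure G) [SFinite lam] [lam.IsMulRightInvariant]
    {μ : Measure (MarkedConfig G Ξ)} (hμ : IsErgodicInvariant μ) {U : Set G}
    (hU : MeasurableSet U) {A : Set (MarkedConfig G Ξ × G)} (hA : MeasurableSet A) :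
    ∫⁻ ω, ∑' x : ↥(ω.points ∩ U), land lam A ω x.1 ∂μ =
      lam U * ∫⁻ ω, ((ω.points ∩ {x | (ω, x) ∈ A}).encard : ℝ≥0∞) ∂μ := by
  have hprob := hμ.isProbabilityMeasure
  have h1 : ∀ ω : MarkedConfig G Ξ, ∑' x : ↥(ω.points ∩ U), land lam A ω x.1 =
      ∫⁻ g, (((ω.points ∩ U) ∩ {x | (g⁻¹ • ω, g⁻¹ * x) ∈ A}).encard : ℝ≥0∞) ∂lam := fun ω =>
    (lintegral_encard_inter lam (ω.countable_points.mono inter_subset_left)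
      (W := {q : G × G | (q.1⁻¹ • ω, q.1⁻¹ * q.2) ∈ A})
      (((MarkedConfig.measurable_smul' measurable_fst.inv measurable_const).prodMk
        (measurable_fst.inv.mul measurable_snd)) hA)).symm
  -- Substituting x = gy after replacing ω by gω moves the relation back to ω and leaves g only in
  -- the condition gy ∈ U.
  have h2 : ∀ (g : G) (ω : MarkedConfig G Ξ),
      ((g • ω).points ∩ U) ∩ {x | (g⁻¹ • g • ω, g⁻¹ * x) ∈ A} =
      (fun y => g * y) '' (ω.points ∩ {y | (ω, y) ∈ A ∧ g * y ∈ U}) := by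
    intro g ω
    ext x
    constructor
    · rintro ⟨⟨h1, h2⟩, h3⟩
      refine ⟨g⁻¹ * x, ⟨(MarkedConfig.mem_smul_points g x ω).1 h1, ?_, by simpa using h2⟩,
        by simp⟩
      simpa using h3
    · rintro ⟨y, ⟨h1, h2, h3⟩, rfl⟩
      refine ⟨⟨(MarkedConfig.mem_smul_points g _ ω).2 (by simpa using h1), h3⟩, ?_⟩
      simpa using h2
  have hm1 : Measurable fun q : MarkedConfig G Ξ × G =>
      (((q.1.points ∩ U) ∩ {x | (q.2⁻¹ • q.1, q.2⁻¹ * x) ∈ A}).encard : ℝ≥0∞) := by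
    have := MarkedConfig.measurable_encard_points (T := MarkedConfig G Ξ × G) (f := Prod.fst)
      measurable_fst
      (W := {r | r.2 ∈ U ∧ (r.1.2⁻¹ • r.1.1, r.1.2⁻¹ * r.2) ∈ A})
      ((measurable_snd hU).inter (((MarkedConfig.measurable_smul'
        (measurable_snd.comp measurable_fst).inv (measurable_fst.comp measurable_fst)).prodMk
        ((measurable_snd.comp measurable_fst).inv.mul measurable_snd)) hA))
    simp only [inter_assoc]
    exact this
  have hm2 : Measurable fun q : MarkedConfig G Ξ × G =>
      ((q.1.points ∩ {y | (q.1, y) ∈ A ∧ q.2 * y ∈ U}).encard : ℝ≥0∞) :=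
    MarkedConfig.measurable_encard_points (T := MarkedConfig G Ξ × G) (f := Prod.fst)
      measurable_fst (W := {r | (r.1.1, r.2) ∈ A ∧ r.1.2 * r.2 ∈ U})
      ((((measurable_fst.comp measurable_fst).prodMk measurable_snd) hA).inter
        (((measurable_snd.comp measurable_fst).mul measurable_snd) hU))
  simp_rw [h1]
  rw [lintegral_lintegral_swap hm1.aemeasurable]
  have h3 : ∀ g : G,
      ∫⁻ ω, (((ω.points ∩ U) ∩ {x | (g⁻¹ • ω, g⁻¹ * x) ∈ A}).encard : ℝ≥0∞) ∂μ =
      ∫⁻ ω, ((ω.points ∩ {y | (ω, y) ∈ A ∧ g * y ∈ U}).encard : ℝ≥0∞) ∂μ := fun g => by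
    refine (hμ.lintegral_smul g (hm1.comp (measurable_prodMk_right (y := g)))).symm.trans ?_
    refine lintegral_congr fun ω => ?_
    simp only [Function.comp_apply]
    rw [h2, (mul_right_injective g).encard_image]
  simp_rw [h3]
  rw [lintegral_lintegral_swap (f := fun (g : G) (ω : MarkedConfig G Ξ) =>
      ((ω.points ∩ {y | (ω, y) ∈ A ∧ g * y ∈ U}).encard : ℝ≥0∞))
      (hm2.comp measurable_swap).aemeasurable,
    ← lintegral_const_mul _ (measurable_encard_fiber hA)]
  refine lintegral_congr fun ω => ?_
  have h4 := lintegral_encard_inter lam (P := ω.points ∩ {y | (ω, y) ∈ A})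
    (ω.countable_points.mono inter_subset_left) (W := {q : G × G | q.1 * q.2 ∈ U})
    ((measurable_fst.mul measurable_snd) hU)
  -- Right invariance makes each related point `y` contribute the same amount λ(U), wherever it
  -- lies.
  have h5 : ∀ y : G, lam {g | g * y ∈ U} = lam U := fun y =>
    measure_preimage_mul_right lam y U
  simp only [mem_ofPred_eq, h5] at h4
  have h6 : ∀ g, ω.points ∩ {y | (ω, y) ∈ A ∧ g * y ∈ U} =
      (ω.points ∩ {y | (ω, y) ∈ A}) ∩ {y | g * y ∈ U} := fun g => by
    rw [inter_assoc]; rfl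
  simp_rw [h6]
  rw [h4, ENNReal.tsum_const, mul_comm]
  rfl

end Transport

section Allocation

variable {G Ξ : Type*} [Group G] [TopologicalSpace G] [IsTopologicalGroup G] [T2Space G]
  [LocallyCompactSpace G] [SecondCountableTopology G] [MeasurableSpace G] [BorelSpace G]
  [MeasurableSpace Ξ] [StandardBorelSpace Ξ]

/-! ## Greedy allocation of land -/

/-- The relation between a configuration and its only point in the window `V`. -/
def uniquePoint (V : Set G) : Set (MarkedConfig G Ξ × G) := {p | p.1.points ∩ V = {p.2}}

theorem measurableSet_uniquePoint {V : Set G} (hV : MeasurableSet V) :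
    MeasurableSet (uniquePoint (Ξ := Ξ) V) := by
  have h1 : MeasurableSet {p : MarkedConfig G Ξ × G | ∃ x ∈ p.1.points, (p, x) ∈
      {q : (MarkedConfig G Ξ × G) × G | q.2 ∈ V ∧ q.2 ≠ q.1.2}} :=
    measurableSet_exists_mem_points measurable_fst ((measurable_snd hV).inter
      (measurableSet_eq_fun measurable_snd (measurable_snd.comp measurable_fst)).compl)
  convert (measurableSet_mem_points.inter (measurable_snd hV)).inter h1.compl using 1
  ext p
  simp only [uniquePoint, mem_ofPred_eq, mem_inter_iff, mem_compl_iff, mem_preimage, not_exists,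
    not_and, not_not]
  constructor
  · intro h
    have hp : p.2 ∈ p.1.points ∩ V := h ▸ mem_singleton p.2
    exact ⟨hp, fun x hx hxV => by simpa [h] using (show x ∈ p.1.points ∩ V from ⟨hx, hxV⟩)⟩
  · rintro ⟨hp, h⟩
    exact Subset.antisymm (fun x hx => h x hx.1 hx.2) (singleton_subset_iff.2 hp)

/-- A section can be extended by sites outside of its domain that see `x` as their only point in
the window `V`, until there is no such site left or the point `x` owns land of measure `c`. -/
theorem exists_extend_section [NeBot (𝓝[≠] (1 : G))] (lam : Measure G) [lam.IsHaarMeasure]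
    [lam.IsMulRightInvariant] {c : ℝ≥0∞}
    {A : Set (MarkedConfig G Ξ × G)} (hA : IsSection A) (hAc : ∀ ω x, land lam A ω x ≤ c)
    {V : Set G} (hV : MeasurableSet V) (hVfin : lam V ≠ ∞) :
    ∃ A' : Set (MarkedConfig G Ξ × G), IsSection A' ∧ A ⊆ A' ∧ (∀ ω x, land lam A' ω x ≤ c) ∧
      ∀ ω x, (ω, x) ∈ uniquePoint V → ω ∈ domain A' ∨ land lam A' ω x = c := by
  have hinv := isInvInvariant_of_isMulRightInvariant lam
  -- An injection into the line ranks the sites, so that a point can take its candidates in order of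
  -- rank until its quota is reached.
  obtain ⟨t₀, ht₀, hinj₀⟩ :=
    MeasurableSpace.measurable_injection_nat_bool_of_countablySeparated G
  obtain ⟨e, he⟩ := exists_measurableEmbedding_real (ℕ → Bool)
  set t : G → ℝ := fun g => e (t₀ g)
  have ht : Measurable t := he.measurable.comp ht₀
  have hinj : Function.Injective t := he.injective.comp hinj₀
  -- Evaluated at g⁻¹ω and g⁻¹x, this says that the site g is still unallocated and sees x as the
  -- only point in `V`.
  set C : Set (MarkedConfig G Ξ × G) := uniquePoint V ∩ {p | p.1 ∉ domain A}
  have hC : MeasurableSet C :=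
    (measurableSet_uniquePoint hV).inter (measurable_fst hA.measurableSet_domain.compl)
  -- the candidates for the land of `x`, and the load at level `r`
  set S : MarkedConfig G Ξ → G → Set G := fun ω x => {g | (g⁻¹ • ω, g⁻¹ * x) ∈ C}
  set F : MarkedConfig G Ξ → G → G → ℝ≥0∞ := fun ω x y =>
    lam (S ω x ∩ {g | t (x⁻¹ * g) ≤ t (x⁻¹ * y)})
  have hSsub : ∀ ω x, S ω x ⊆ {g | g⁻¹ * x ∈ V} := fun ω x g hg => by
    have h : (g⁻¹ • ω).points ∩ V = {g⁻¹ * x} := hg.1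
    exact (h ▸ mem_singleton (g⁻¹ * x) : g⁻¹ * x ∈ (g⁻¹ • ω).points ∩ V).2
  have hSfin : ∀ ω x, lam (S ω x) ≠ ∞ := fun ω x => by
    refine ne_top_of_le_ne_top hVfin ((measure_mono (hSsub ω x)).trans_eq ?_)
    have h1 : {g : G | g⁻¹ * x ∈ V} = (fun g => g⁻¹) ⁻¹' ((fun g => g * x) ⁻¹' V) := rfl
    rw [h1]
    exact (Measure.measure_preimage_inv lam _).trans (measure_preimage_mul_right lam x V)
  have hSh : ∀ h ω x g, g ∈ S (h⁻¹ • ω) (h⁻¹ * x) ↔ h * g ∈ S ω x := fun h ω x g => by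
    simp only [S, mem_ofPred_eq, mul_inv_rev, mul_smul, mul_assoc]
  -- Sites are ranked relative to `x`, through `x⁻¹ * g`, so the load is translation invariant: its
  -- value at the site `h` of ω can be read at the identity of `h⁻¹ • ω`.
  have hFh : ∀ h ω x, F (h⁻¹ • ω) (h⁻¹ * x) 1 = F ω x h := fun h ω x => by
    have hset : S (h⁻¹ • ω) (h⁻¹ * x) ∩ {g | t ((h⁻¹ * x)⁻¹ * g) ≤ t ((h⁻¹ * x)⁻¹ * 1)} =
        (fun g => h * g) ⁻¹' (S ω x ∩ {g | t (x⁻¹ * g) ≤ t (x⁻¹ * h)}) := by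
      ext g
      simp only [mem_inter_iff, mem_preimage, hSh]
      simp [mul_assoc]
    simp only [F]
    rw [hset, measure_preimage_mul]
  have hFm : Measurable fun p : MarkedConfig G Ξ × G => F p.1 p.2 1 := by
    refine measurable_measure_prodMk_left (s := {q : (MarkedConfig G Ξ × G) × G |
      (q.2⁻¹ • q.1.1, q.2⁻¹ * q.1.2) ∈ C ∧ t (q.1.2⁻¹ * q.2) ≤ t (q.1.2⁻¹ * 1)}) ?_
    exact (measurable_shift hC).inter (measurableSet_le
      (ht.comp ((measurable_snd.comp measurable_fst).inv.mul measurable_snd))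
      (ht.comp ((measurable_snd.comp measurable_fst).inv.mul measurable_const)))
  -- A candidate is accepted while the load up to its rank fits into the remaining capacity.
  set B : Set (MarkedConfig G Ξ × G) := C ∩ {p | F p.1 p.2 1 ≤ c - land lam A p.1 p.2}
  have hB : MeasurableSet B := hC.inter
    (measurableSet_le hFm (measurable_const.sub (measurable_land lam hA.measurableSet)))
  have hlandB : ∀ ω x, land lam B ω x = min (lam (S ω x)) (c - land lam A ω x) := fun ω x => by
    -- Nondiscreteness enters here: Haar measure has no atoms, so cutting along ranks fills exactly
    -- the capacity or uses up all candidates.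
    have h := measure_inter_setOf_le lam (t := fun g => t (x⁻¹ * g))
      (ht.comp (measurable_const_mul _)) (hinj.comp (mul_right_injective _)) (hSfin ω x)
      (c - land lam A ω x)
    rw [← h, land]
    congr 1
    ext g
    simp only [B, mem_inter_iff, mem_ofPred_eq, hFh, land_smul]
    rfl
  have hland : ∀ ω x, land lam (A ∪ B) ω x = land lam A ω x + land lam B ω x := fun ω x => by
    have hdis : Disjoint {g : G | (g⁻¹ • ω, g⁻¹ * x) ∈ A} {g : G | (g⁻¹ • ω, g⁻¹ * x) ∈ B} :=
      disjoint_left.2 fun g hgA hgB => hgB.1.2 ⟨_, hgA⟩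
    exact measure_union hdis (measurableSet_shift hB ω x)
  refine ⟨A ∪ B, ⟨hA.measurableSet.union hB, ?_, ?_⟩, subset_union_left, ?_, ?_⟩
  · rintro ω x (h | h)
    · exact hA.mem_points ω x h
    · have h' : ω.points ∩ V = {x} := h.1.1
      exact (h' ▸ mem_singleton x : x ∈ ω.points ∩ V).1
  · rintro ω x y (hx | hx) (hy | hy)
    · exact hA.unique ω x y hx hy
    · exact absurd ⟨_, hx⟩ hy.1.2
    · exact absurd ⟨_, hy⟩ hx.1.2
    · have h1 : ω.points ∩ V = {x} := hx.1.1
      have h2 : ω.points ∩ V = {y} := hy.1.1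
      exact singleton_injective (h1.symm.trans h2)
  · intro ω x
    rw [hland, hlandB]
    exact (add_le_add_right (min_le_right _ _) _).trans_eq (add_tsub_cancel_of_le (hAc ω x))
  · intro ω x hx
    by_cases hdom : ω ∈ domain (A ∪ B)
    · exact Or.inl hdom
    right
    have hxC : (ω, x) ∈ C := ⟨hx, fun ⟨y, hy⟩ => hdom ⟨y, Or.inl hy⟩⟩
    -- The identity was a candidate and was refused, so the candidates already exceed the capacity.
    have hxB : c - land lam A ω x < F ω x 1 := by
      by_contra h
      exact hdom ⟨x, Or.inr ⟨hxC, not_lt.1 h⟩⟩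
    have hle : c - land lam A ω x ≤ lam (S ω x) := hxB.le.trans (measure_mono inter_subset_left)
    rw [hland, hlandB, min_eq_right hle, add_tsub_cancel_of_le (hAc ω x)]

theorem land_iUnion (lam : Measure G) {A : ℕ → Set (MarkedConfig G Ξ × G)} (hA : Monotone A)
    (ω : MarkedConfig G Ξ) (x : G) : land lam (⋃ n, A n) ω x = ⨆ n, land lam (A n) ω x := by
  have h : {g : G | (g⁻¹ • ω, g⁻¹ * x) ∈ ⋃ n, A n} =
      ⋃ n, {g : G | (g⁻¹ • ω, g⁻¹ * x) ∈ A n} := by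
    ext g; simp
  rw [land, h]
  exact Monotone.measure_iUnion fun m n hmn g hg => hA hmn hg

/-- Windows from a countable family isolate every point of every configuration. -/
theorem exists_isolating_windows (lam : Measure G) [lam.IsHaarMeasure] :
    ∃ V : ℕ → Set G, (∀ n, MeasurableSet (V n)) ∧ (∀ n, lam (V n) ≠ ∞) ∧
      ∀ (ω : MarkedConfig G Ξ), ∀ x ∈ ω.points, ∃ n, (ω, x) ∈ uniquePoint (V n) := by
  obtain ⟨b, hbc, -, hb⟩ := TopologicalSpace.exists_countable_basis G
  set b' : Set (Set G) := {V ∈ b | lam V < ∞}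
  have hkey : ∀ (ω : MarkedConfig G Ξ), ∀ x ∈ ω.points, ∃ V ∈ b', (ω, x) ∈ uniquePoint V := by
    intro ω x hx
    obtain ⟨K, hK, hKx⟩ := exists_compact_mem_nhds x
    have hfin : (ω.points ∩ K).Finite := by
      rw [← encard_lt_top_iff, ω.encard_points_inter, encard_lt_top_iff]
      exact ω.locally_finite K hK
    -- Only finitely many other points lie in `K`, so removing them leaves a neighbourhood of `x`.
    have hnhds : K ∩ ((ω.points ∩ K) \ {x})ᶜ ∈ 𝓝 x :=
      inter_mem hKx ((hfin.subset sdiff_subset).isClosed.isOpen_compl.mem_nhds (by simp))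
    obtain ⟨V, hVb, hxV, hVsub⟩ := hb.mem_nhds_iff.1 hnhds
    refine ⟨V, ⟨hVb, (measure_mono (hVsub.trans inter_subset_left)).trans_lt hK.measure_lt_top⟩,
      Subset.antisymm (fun y hy => ?_) (singleton_subset_iff.2 ⟨hx, hxV⟩)⟩
    by_contra hne
    exact (hVsub hy.2).2 ⟨⟨hy.1, (hVsub hy.2).1⟩, hne⟩
  -- The empty window only makes the family nonempty, so that it can be enumerated by ℕ.
  have hcount : (insert ∅ b').Countable := (hbc.mono (sep_subset _ _)).insert _
  obtain ⟨V, hV⟩ := hcount.exists_eq_range (insert_nonempty _ _)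
  have hmem : ∀ n, V n ∈ insert ∅ b' := fun n => hV ▸ mem_range_self n
  refine ⟨V, fun n => ?_, fun n => ?_, fun ω x hx => ?_⟩
  · rcases hmem n with h | h
    · rw [h]; exact MeasurableSet.empty
    · exact (hb.isOpen h.1).measurableSet
  · rcases hmem n with h | h
    · simp [h]
    · exact h.2.ne
  · obtain ⟨W, hW, h⟩ := hkey ω x hx
    obtain ⟨n, rfl⟩ : W ∈ range V := hV ▸ mem_insert_of_mem _ hW
    exact ⟨n, h⟩

/-- There is a section under which no point owns land of measure more than `c`, and no
configuration contains both an unallocated site and a point owning less than `c`. -/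
theorem exists_greedy_section [NeBot (𝓝[≠] (1 : G))] (lam : Measure G) [lam.IsHaarMeasure]
    [lam.IsMulRightInvariant] (c : ℝ≥0∞) :
    ∃ A : Set (MarkedConfig G Ξ × G), IsSection A ∧ (∀ ω x, land lam A ω x ≤ c) ∧
      ∀ ω, ∀ x ∈ ω.points, ω ∈ domain A ∨ land lam A ω x = c := by
  obtain ⟨V, hVm, hVfin, hV⟩ := exists_isolating_windows (Ξ := Ξ) lam
  let T := {A : Set (MarkedConfig G Ξ × G) // IsSection A ∧ ∀ ω x, land lam A ω x ≤ c}
  have hext : ∀ (n : ℕ) (A : T), ∃ A' : T, A.1 ⊆ A'.1 ∧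
      ∀ ω x, (ω, x) ∈ uniquePoint (V n) → ω ∈ domain A'.1 ∨ land lam A'.1 ω x = c := by
    rintro n ⟨A, hA, hAc⟩
    obtain ⟨A', h1, h2, h3, h4⟩ := exists_extend_section lam hA hAc (hVm n) (hVfin n)
    exact ⟨⟨A', h1, h3⟩, h2, h4⟩
  choose next hnext1 hnext2 using hext
  let A₀ : T := ⟨∅, ⟨MeasurableSet.empty, by simp, by simp⟩, by simp [land]⟩
  let A : ℕ → T := fun n => Nat.rec A₀ next n
  have hmono : Monotone fun n => (A n).1 := monotone_nat_of_le_succ fun n => hnext1 n (A n)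
  have hle : ∀ ω x, land lam (⋃ n, (A n).1) ω x ≤ c := fun ω x => by
    rw [land_iUnion lam hmono]
    exact iSup_le fun n => (A n).2.2 ω x
  refine ⟨⋃ n, (A n).1, ⟨MeasurableSet.iUnion fun n => (A n).2.1.measurableSet, ?_, ?_⟩, hle, ?_⟩
  · intro ω x h
    obtain ⟨n, hn⟩ := mem_iUnion.1 h
    exact (A n).2.1.mem_points ω x hn
  · intro ω x y hx hy
    obtain ⟨m, hm⟩ := mem_iUnion.1 hx
    obtain ⟨n, hn⟩ := mem_iUnion.1 hy
    exact (A (max m n)).2.1.unique ω x y (hmono (le_max_left m n) hm)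
      (hmono (le_max_right m n) hn)
  · intro ω x hx
    obtain ⟨n, hn⟩ := hV ω x hx
    -- One visit to each window suffices: later stages keep both alternatives, since domains grow
    -- and land grows but never beyond `c`.
    rcases hnext2 n (A n) ω x hn with ⟨y, hy⟩ | h
    · exact Or.inl ⟨y, mem_iUnion.2 ⟨n + 1, hy⟩⟩
    · refine Or.inr (le_antisymm (hle ω x) ?_)
      rw [land_iUnion lam hmono]
      exact h.ge.trans (le_iSup (fun k => land lam (A k).1 ω x) (n + 1))

end Allocation

section Balance

variable {G Ξ : Type*} [Group G] [TopologicalSpace G] [IsTopologicalGroup G] [T2Space G]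
  [LocallyCompactSpace G] [SecondCountableTopology G] [MeasurableSpace G] [BorelSpace G]
  [MeasurableSpace Ξ] [StandardBorelSpace Ξ]

/-! ## Balanced sections -/

/-- A section relates ω to at most one point, so the count is the indicator of the domain. This
turns the right side of mass transport into a probability. -/
theorem IsSection.lintegral_encard_fiber {A : Set (MarkedConfig G Ξ × G)} (hA : IsSection A)
    (μ : Measure (MarkedConfig G Ξ)) :
    ∫⁻ ω, ((ω.points ∩ {x | (ω, x) ∈ A}).encard : ℝ≥0∞) ∂μ = μ (domain A) := by
  rw [← lintegral_indicator_one hA.measurableSet_domain]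
  refine lintegral_congr fun ω => ?_
  by_cases h : ω ∈ domain A
  · obtain ⟨x, hx⟩ := h
    have hset : ω.points ∩ {x | (ω, x) ∈ A} = {x} := by
      ext y
      exact ⟨fun hy => hA.unique ω y x hy.2 hx, fun hy => by
        rw [mem_singleton_iff.1 hy]; exact ⟨hA.mem_points ω x hx, hx⟩⟩
    rw [hset, indicator_of_mem (show ω ∈ domain A from ⟨x, hx⟩)]
    simp
  · have hset : ω.points ∩ {x | (ω, x) ∈ A} = ∅ := by
      ext y
      exact ⟨fun hy => h ⟨y, hy.2⟩, fun hy => hy.elim⟩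
    rw [hset, indicator_of_notMem h]
    simp

theorem tsum_points_const (ω : MarkedConfig G Ξ) (S : Set G) (c : ℝ≥0∞) :
    ∑' _ : ↥(ω.points ∩ S), c = c * ((ω.points ∩ S).encard : ℝ≥0∞) := by
  rw [ENNReal.tsum_const, mul_comm]
  rfl

theorem measurable_pointCount {U : Set G} (hU : MeasurableSet U) :
    Measurable (MarkedConfig.pointCount (Ξ := Ξ) U) :=
  measurable_encard_fiber (A := {p | p.2 ∈ U}) (measurable_snd hU)

/-- This is the expected land owned by the points in U when each owns exactly its quota, the
extremal value in the saturation argument. -/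
theorem lintegral_inv_intensity_mul_pointCount (lam : Measure G) {U : Set G}
    (hU : MeasurableSet U) (hU_pos : lam U ≠ 0) (hU_fin : lam U ≠ ∞)
    {μ : Measure (MarkedConfig G Ξ)}
    (hμ_pos : intensity lam U μ ≠ 0) (hμ_fin : intensity lam U μ ≠ ∞) :
    ∫⁻ ω, (intensity lam U μ)⁻¹ * MarkedConfig.pointCount U ω ∂μ = lam U := by
  rw [lintegral_const_mul _ (measurable_pointCount hU)]
  have h : ∫⁻ ω, MarkedConfig.pointCount U ω ∂μ = intensity lam U μ * lam U :=
    (ENNReal.div_mul_cancel hU_pos hU_fin).symm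
  rw [h, ← mul_assoc, ENNReal.inv_mul_cancel hμ_pos hμ_fin, one_mul]

/-- An ergodic point process has a section that is almost surely defined and under which almost
surely every point owns land of measure `intensity⁻¹`. -/
theorem exists_balanced_section [NeBot (𝓝[≠] (1 : G))] (lam : Measure G) [lam.IsHaarMeasure]
    [lam.IsMulRightInvariant] {U : Set G} (hU : MeasurableSet U) (hU_pos : lam U ≠ 0)
    (hU_fin : lam U ≠ ∞) {μ : Measure (MarkedConfig G Ξ)} (hμ : IsErgodicInvariant μ)
    (hμ_pos : intensity lam U μ ≠ 0) (hμ_fin : intensity lam U μ ≠ ∞) :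
    ∃ A : Set (MarkedConfig G Ξ × G), IsSection A ∧ (∀ᵐ ω ∂μ, ω ∈ domain A) ∧
      ∀ᵐ ω ∂μ, ∀ x ∈ ω.points, land lam A ω x = (intensity lam U μ)⁻¹ := by
  have hprob := hμ.isProbabilityMeasure
  have hinv := isInvInvariant_of_isMulRightInvariant lam
  set c := (intensity lam U μ)⁻¹
  have hc : c ≠ ∞ := ENNReal.inv_ne_top.2 hμ_pos
  have hcount : ∫⁻ ω, c * MarkedConfig.pointCount U ω ∂μ = lam U :=
    lintegral_inv_intensity_mul_pointCount lam hU hU_pos hU_fin hμ_pos hμ_fin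
  obtain ⟨A, hA, hle, hor⟩ := exists_greedy_section (Ξ := Ξ) lam c
  have hmass := mass_transport lam hμ hU hA.measurableSet
  rw [hA.lintegral_encard_fiber] at hmass
  set N : Set (MarkedConfig G Ξ × G) := {p | land lam A p.1 p.2 ≠ c}
  have hN : MeasurableSet N :=
    (measurableSet_eq_fun (measurable_land lam hA.measurableSet) measurable_const).compl
  have hNh : ∀ h ω x, (h • ω, h * x) ∈ N ↔ (ω, x) ∈ N := fun h ω x => by
    simp only [N, mem_ofPred_eq, land_smul]
  -- Possession of an unsaturated point is a translation invariant event, so ergodicity applies to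
  -- it.
  set B : Set (MarkedConfig G Ξ) := {ω | ∃ x ∈ ω.points, (ω, x) ∈ N}
  have hB : MeasurableSet B := measurableSet_exists_mem_points measurable_id hN
  have hBh : ∀ (g : G), ∀ ω ∈ B, g • ω ∈ B := by
    rintro g ω ⟨x, hx, hxN⟩
    exact ⟨g * x, (MarkedConfig.mem_smul_points g _ ω).2 (by simpa using hx), (hNh g ω x).2 hxN⟩
  have hB0 : μ B = 0 := by
    refine (hμ.ergodic B hB hBh).resolve_right fun hB1 => ?_
    have hBae : ∀ᵐ ω ∂μ, ω ∈ B := (prob_compl_eq_zero_iff hB).2 hB1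
    have hdom : μ (domain A) = 1 := by
      refine le_antisymm prob_le_one (hB1.ge.trans (measure_mono ?_))
      rintro ω ⟨x, hx, hxN⟩
      exact (hor ω x hx).resolve_right hxN
    rw [hdom, mul_one] at hmass
    have hsum_le : ∀ ω : MarkedConfig G Ξ, ∑' x : ↥(ω.points ∩ U), land lam A ω x.1 ≤
        c * MarkedConfig.pointCount U ω := fun ω =>
      (ENNReal.tsum_le_tsum fun x => hle ω x.1).trans_eq (tsum_points_const ω U c)
    -- The land owned is at most the total quota and has the same finite mean, so the two agree
    -- almost surely.
    have hsum : ∀ᵐ ω ∂μ, ∑' x : ↥(ω.points ∩ U), land lam A ω x.1 =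
        c * MarkedConfig.pointCount U ω :=
      ae_eq_of_ae_le_of_lintegral_le (ae_of_all _ hsum_le) (hmass ▸ hU_fin)
        ((measurable_pointCount hU).const_mul c).aemeasurable (hcount.trans hmass.symm).le
    have hfin : ∀ᵐ ω ∂μ, c * MarkedConfig.pointCount U ω < ∞ :=
      ae_lt_top ((measurable_pointCount hU).const_mul c) (hcount ▸ hU_fin)
    have hsat : ∀ᵐ ω ∂μ, ω.points ∩ {x | (ω, x) ∈ N ∩ {p | p.2 ∈ U}} = ∅ := by
      filter_upwards [hsum, hfin] with ω h1 h2
      rw [eq_empty_iff_forall_notMem]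
      rintro x ⟨hx, hxN, hxU⟩
      have hlt := ENNReal.tsum_lt_tsum (f := fun x : ↥(ω.points ∩ U) => land lam A ω x.1)
        (g := fun _ => c) (i := ⟨x, hx, hxU⟩) (h1 ▸ h2.ne) (fun x => hle ω x.1)
        (lt_of_le_of_ne (hle ω x) hxN)
      rw [tsum_points_const] at hlt
      exact hlt.ne h1
    -- Saturation is so far known only inside U. To reach all of G, each unsaturated point is given
    -- the sites g with g⁻¹x ∈ U, a set of measure λ(U). The mean of what is received is then at
    -- least λ(U), although almost surely nothing is sent.
    have hmassN := mass_transport lam hμ MeasurableSet.univ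
      (hN.inter (measurable_snd hU))
    have hzero : ∫⁻ ω, ((ω.points ∩ {x | (ω, x) ∈ N ∩ {p | p.2 ∈ U}}).encard : ℝ≥0∞) ∂μ = 0 := by
      rw [← lintegral_zero (μ := μ)]
      refine lintegral_congr_ae ?_
      filter_upwards [hsat] with ω h
      rw [h]
      simp
    have hge : lam U ≤ ∫⁻ ω, ∑' x : ↥(ω.points ∩ univ),
        land lam (N ∩ Prod.snd ⁻¹' U) ω x.1 ∂μ := by
      calc lam U = ∫⁻ _, lam U ∂μ := by simp
        _ ≤ _ := by
          refine lintegral_mono_ae ?_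
          filter_upwards [hBae] with ω hω
          obtain ⟨x, hx, hxN⟩ := hω
          refine le_trans (le_of_eq ?_) (ENNReal.le_tsum
            (f := fun x : ↥(ω.points ∩ univ) => land lam (N ∩ Prod.snd ⁻¹' U) ω x.1)
            ⟨x, hx, mem_univ x⟩)
          have hset : {g : G | (g⁻¹ • ω, g⁻¹ * x) ∈ N ∩ Prod.snd ⁻¹' U} =
              (fun g => g⁻¹) ⁻¹' ((fun g => g * x) ⁻¹' U) := by
            ext g
            exact ⟨fun h => h.2, fun h => ⟨(hNh _ _ _).2 hxN, h⟩⟩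
          change _ = land lam _ ω x
          rw [land, hset, Measure.measure_preimage_inv, measure_preimage_mul_right]
    rw [hmassN] at hge
    refine hU_pos (le_zero_iff.1 (hge.trans_eq ?_))
    -- The factor λ(G) may be infinite; its product with 0 is still 0.
    exact mul_eq_zero_of_right _ hzero
  have hbal : ∀ᵐ ω ∂μ, ∀ x ∈ ω.points, land lam A ω x = c := by
    filter_upwards [measure_eq_zero_iff_ae_notMem.1 hB0] with ω hω x hx
    by_contra h
    exact hω ⟨x, hx, h⟩
  refine ⟨A, hA, ?_, hbal⟩
  have hsum : ∫⁻ ω, ∑' x : ↥(ω.points ∩ U), land lam A ω x.1 ∂μ = lam U := by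
    rw [← hcount]
    refine lintegral_congr_ae ?_
    filter_upwards [hbal] with ω hω
    refine Eq.trans ?_ (tsum_points_const ω U c)
    exact tsum_congr fun x => hω x.1 x.2.1
  rw [hsum] at hmass
  refine (prob_compl_eq_zero_iff hA.measurableSet_domain).2 ?_
  rw [← ENNReal.mul_right_inj hU_pos hU_fin, ← hmass, mul_one]

/-! ## Head maps -/

theorem isSection_uniquePoint {V : Set G} (hV : MeasurableSet V) :
    IsSection (uniquePoint (Ξ := Ξ) V) where
  measurableSet := measurableSet_uniquePoint hV
  mem_points ω x h := by
    have h' : ω.points ∩ V = {x} := h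
    exact (h' ▸ mem_singleton x : x ∈ ω.points ∩ V).1
  unique ω x y hx hy := by
    have h1 : ω.points ∩ V = {x} := hx
    have h2 : ω.points ∩ V = {y} := hy
    exact singleton_injective (h1.symm.trans h2)

/-- There is a section defined on all nonempty configurations. -/
theorem exists_section_of_nonempty (lam : Measure G) [lam.IsHaarMeasure] :
    ∃ S : Set (MarkedConfig G Ξ × G), IsSection S ∧
      ∀ ω : MarkedConfig G Ξ, ω.points.Nonempty → ω ∈ domain S := by
  classical
  obtain ⟨V, hVm, -, hV⟩ := exists_isolating_windows (Ξ := Ξ) lam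
  -- The chosen point is the one isolated by the first window that contains exactly one point.
  refine ⟨⋃ n, uniquePoint (V n) ∩ ⋂ m < n, {p | p.1 ∉ domain (uniquePoint (V m))},
    ⟨?_, ?_, ?_⟩, ?_⟩
  · refine MeasurableSet.iUnion fun n => (measurableSet_uniquePoint (hVm n)).inter
      (MeasurableSet.iInter fun m => MeasurableSet.iInter fun _ => ?_)
    exact measurable_fst (isSection_uniquePoint (hVm m)).measurableSet_domain.compl
  · intro ω x h
    obtain ⟨n, hn, -⟩ := mem_iUnion.1 h
    exact (isSection_uniquePoint (hVm n)).mem_points ω x hn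
  · intro ω x y hx hy
    obtain ⟨m, hm, hm'⟩ := mem_iUnion.1 hx
    obtain ⟨n, hn, hn'⟩ := mem_iUnion.1 hy
    rcases lt_trichotomy m n with h | rfl | h
    · exact absurd ⟨x, hm⟩ (mem_iInter₂.1 hn' m h)
    · exact (isSection_uniquePoint (hVm m)).unique ω x y hm hn
    · exact absurd ⟨y, hn⟩ (mem_iInter₂.1 hm' n h)
  · rintro ω ⟨x, hx⟩
    have hex : ∃ n, ω ∈ domain (uniquePoint (V n)) := by
      obtain ⟨n, hn⟩ := hV ω x hx
      exact ⟨n, x, hn⟩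
    obtain ⟨y, hy⟩ := Nat.find_spec hex
    exact ⟨y, mem_iUnion.2 ⟨Nat.find hex, hy, mem_iInter₂.2 fun m hm => Nat.find_min hex hm⟩⟩

/-- By Fubini and invariance, an almost sure property of the configuration seen from the identity
holds from almost every site. -/
theorem IsErgodicInvariant.ae_ae_smul_mem {μ : Measure (MarkedConfig G Ξ)}
    (hμ : IsErgodicInvariant μ) (lam : Measure G) [SFinite lam] {S : Set (MarkedConfig G Ξ)}
    (hS : MeasurableSet S) (h : ∀ᵐ ω ∂μ, ω ∈ S) :
    ∀ᵐ ω ∂μ, ∀ᵐ g ∂lam, g⁻¹ • ω ∈ S := by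
  have hprob := hμ.isProbabilityMeasure
  have hm : MeasurableSet {q : MarkedConfig G Ξ × G | q.2⁻¹ • q.1 ∈ Sᶜ} :=
    (MarkedConfig.measurable_smul' measurable_snd.inv measurable_fst) hS.compl
  have hnull : (μ.prod lam) {q : MarkedConfig G Ξ × G | q.2⁻¹ • q.1 ∈ Sᶜ} = 0 := by
    rw [Measure.prod_apply_symm hm, ← lintegral_zero (μ := lam)]
    refine lintegral_congr fun g => ?_
    exact (hμ.measure_setOf_smul g⁻¹ hS.compl).trans h
  exact Measure.measure_ae_null_of_prod_null hnull

/-- An ergodic point process has a measurable choice of a point of each nonempty configuration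
under which almost surely every point owns land of measure `intensity⁻¹`. -/
theorem exists_head_map [NeBot (𝓝[≠] (1 : G))] (lam : Measure G) [lam.IsHaarMeasure]
    [lam.IsMulRightInvariant] {U : Set G} (hU : MeasurableSet U) (hU_pos : lam U ≠ 0)
    (hU_fin : lam U ≠ ∞) {μ : Measure (MarkedConfig G Ξ)} (hμ : IsErgodicInvariant μ)
    (hμ_pos : intensity lam U μ ≠ 0) (hμ_fin : intensity lam U μ ≠ ∞) :
    ∃ ℰ : MarkedConfig G Ξ → G, Measurable ℰ ∧ (∀ ω, ω.points.Nonempty → ℰ ω ∈ ω.points) ∧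
      (∀ᵐ ω ∂μ, ω.points.Nonempty) ∧
      ∀ᵐ ω ∂μ, ∀ x ∈ ω.points, lam {g | g * ℰ (g⁻¹ • ω) = x} = (intensity lam U μ)⁻¹ := by
  classical
  obtain ⟨A, hA, hdom, hbal⟩ := exists_balanced_section lam hU hU_pos hU_fin hμ hμ_pos hμ_fin
  obtain ⟨S, hS, hSdom⟩ := exists_section_of_nonempty (Ξ := Ξ) lam
  -- The auxiliary section fills in where the balanced one is undefined. The head is then a point of
  -- every nonempty configuration, which lets the groupoid identities hold everywhere.
  set T : Set (MarkedConfig G Ξ × G) := A ∪ (S ∩ {p | p.1 ∉ domain A})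
  have hT : IsSection T := by
    refine ⟨hA.measurableSet.union (hS.measurableSet.inter
      (measurable_fst hA.measurableSet_domain.compl)), ?_, ?_⟩
    · rintro ω x (h | h)
      · exact hA.mem_points ω x h
      · exact hS.mem_points ω x h.1
    · rintro ω x y (hx | hx) (hy | hy)
      · exact hA.unique ω x y hx hy
      · exact absurd ⟨x, hx⟩ hy.2
      · exact absurd ⟨y, hy⟩ hx.2
      · exact hS.unique ω x y hx.1 hy.1
  have hTdom : ∀ ω : MarkedConfig G Ξ, ω.points.Nonempty → ω ∈ domain T := fun ω hω => by
    by_cases h : ω ∈ domain A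
    · obtain ⟨x, hx⟩ := h
      exact ⟨x, Or.inl hx⟩
    · obtain ⟨x, hx⟩ := hSdom ω hω
      exact ⟨x, Or.inr ⟨hx, h⟩⟩
  let ℰ : MarkedConfig G Ξ → G := fun ω => if h : ∃ x, (ω, x) ∈ T then h.choose else 1
  have hℰ : ∀ ω : MarkedConfig G Ξ, ω.points.Nonempty → (ω, ℰ ω) ∈ T := fun ω hω => by
    have h : ∃ x, (ω, x) ∈ T := hTdom ω hω
    simp only [ℰ, dif_pos h]
    exact h.choose_spec
  have hℰiff : ∀ ω : MarkedConfig G Ξ, ω.points.Nonempty → ∀ x, ℰ ω = x ↔ (ω, x) ∈ T :=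
    fun ω hω x => ⟨fun h => h ▸ hℰ ω hω, fun h => hT.unique ω _ _ (hℰ ω hω) h⟩
  have hne : ∀ᵐ ω ∂μ, ω.points.Nonempty := by
    filter_upwards [hdom] with ω hω
    obtain ⟨x, hx⟩ := hω
    exact ⟨x, hA.mem_points ω x hx⟩
  refine ⟨ℰ, fun V hV => ?_, fun ω hω => hT.mem_points ω _ (hℰ ω hω), hne, ?_⟩
  · have hset : ℰ ⁻¹' V = {ω | ∃ x ∈ ω.points, (ω, x) ∈ T ∩ Prod.snd ⁻¹' V} ∪
        ({ω | ω.points.Nonempty}ᶜ ∩ {_ω | (1 : G) ∈ V}) := by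
      ext ω
      by_cases hω : ω.points.Nonempty
      · constructor
        · intro h
          exact Or.inl ⟨ℰ ω, hT.mem_points ω _ (hℰ ω hω), hℰ ω hω, h⟩
        · rintro (⟨x, -, hxT, hxV⟩ | h)
          · exact mem_preimage.2 (((hℰiff ω hω x).2 hxT).symm ▸ hxV)
          · exact absurd hω h.1
      · have h1 : ¬ ∃ x, (ω, x) ∈ T := fun ⟨x, hx⟩ => hω ⟨x, hT.mem_points ω x hx⟩
        have h2 : ℰ ω = 1 := dif_neg h1
        constructor
        · intro h
          have h' : ℰ ω ∈ V := h
          exact Or.inr ⟨hω, show (1 : G) ∈ V from h2 ▸ h'⟩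
        · rintro (⟨x, hx, -⟩ | h)
          · exact absurd ⟨x, hx⟩ hω
          · exact mem_preimage.2 (h2.symm ▸ h.2)
    rw [hset]
    exact (measurableSet_exists_mem_points measurable_id
      (hT.measurableSet.inter (measurable_snd hV))).union
      (measurableSet_points_nonempty.compl.inter (MeasurableSet.const _))
  -- From almost every site the balanced section is defined and agrees with the head, so the
  -- correction does not change the measure of any cell.
  · filter_upwards [hbal, hne, hμ.ae_ae_smul_mem lam hA.measurableSet_domain hdom]
      with ω h1 h2 h3 x hx
    rw [← h1 x hx, land]
    refine measure_congr ?_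
    filter_upwards [h3] with g hg
    have hne' : (g⁻¹ • ω).points.Nonempty := (points_smul_nonempty_iff _ _).2 h2
    refine propext ?_
    change g * ℰ (g⁻¹ • ω) = x ↔ (g⁻¹ • ω, g⁻¹ * x) ∈ A
    rw [← eq_inv_mul_iff_mul_eq, hℰiff _ hne']
    exact ⟨fun h => h.resolve_right fun h' => h'.2 hg, fun h => Or.inl h⟩

end Balance

noncomputable section FactorMap

variable {G Ξ : Type*} [Group G] [TopologicalSpace G] [IsTopologicalGroup G] [T2Space G]
  [LocallyCompactSpace G] [SecondCountableTopology G] [MeasurableSpace G] [BorelSpace G]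
  [MeasurableSpace Ξ] [StandardBorelSpace Ξ]

/-! ## The action groupoid -/

/-- Inversion of the Haar variable uses unimodularity; the remaining translation of ω is absorbed by
invariance of `μ`. -/
theorem isPMP_actionGroupoid (lam : Measure G) [lam.IsHaarMeasure] [lam.IsMulRightInvariant]
    {μ : Measure (MarkedConfig G Ξ)} (hμ : IsErgodicInvariant μ) :
    (actionGroupoid lam μ).IsPMP := by
  have hprob := hμ.isProbabilityMeasure
  have hinv := isInvInvariant_of_isMulRightInvariant lam
  refine ⟨hprob, ?_⟩
  change (lam.prod μ).map (actionGroupoid lam μ).inv = lam.prod μ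
  refine Measure.ext fun S hS => ?_
  rw [Measure.map_apply (actionGroupoid lam μ).measurable_inv hS,
    Measure.prod_apply ((actionGroupoid lam μ).measurable_inv hS), Measure.prod_apply hS,
    ← lintegral_inv_eq_self (μ := lam)]
  refine lintegral_congr fun g => ?_
  refine Eq.trans ?_ (hμ.measure_setOf_smul g (measurable_prodMk_left (x := g) hS))
  congr 1
  ext ω
  change ((g⁻¹)⁻¹, (g⁻¹)⁻¹ • ω) ∈ S ↔ (g, g • ω) ∈ S
  rw [inv_inv]

/-! ## The factor map of a head map -/

open Classical in
/-- The configuration seen from its head; the empty configuration is sent to `ω₀`. -/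
def headUnit (ℰ : MarkedConfig G Ξ → G) (hℰ : ∀ ω, ω.points.Nonempty → ℰ ω ∈ ω.points)
    (ω₀ : RootedConfig G Ξ) (ω : MarkedConfig G Ξ) : RootedConfig G Ξ :=
  if h : ω.points.Nonempty then reroot ω (ℰ ω) (hℰ ω h) else ω₀

/-- The product `g * ℰ (g⁻¹ • ω)` is the owner of the site `g` in ω; the element here is this owner
seen from the head of ω. -/
theorem head_mem_points {ℰ : MarkedConfig G Ξ → G}
    (hℰ : ∀ ω, ω.points.Nonempty → ℰ ω ∈ ω.points) {ω : MarkedConfig G Ξ}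
    (h : ω.points.Nonempty) (g : G) :
    (ℰ ω)⁻¹ * g * ℰ (g⁻¹ • ω) ∈ (reroot ω (ℰ ω) (hℰ ω h)).1.points := by
  have h1 := MarkedConfig.mul_mem_points (hℰ (g⁻¹ • ω) ((points_smul_nonempty_iff _ _).2 h))
  refine (MarkedConfig.mem_smul_points _ _ ω).2 ?_
  rwa [inv_inv, mul_assoc, mul_inv_cancel_left]

open Classical in
/-- The arrow from the head of `ω` to the head of `g⁻¹ • ω`; over the empty configuration it is
the identity of `ω₀`. -/
def headArrow (ℰ : MarkedConfig G Ξ → G) (hℰ : ∀ ω, ω.points.Nonempty → ℰ ω ∈ ω.points)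
    (ω₀ : RootedConfig G Ξ) (a : G × MarkedConfig G Ξ) : BirootedConfig G Ξ :=
  if h : a.2.points.Nonempty then
    ⟨(reroot a.2 (ℰ a.2) (hℰ a.2 h), (ℰ a.2)⁻¹ * a.1 * ℰ (a.1⁻¹ • a.2)),
      head_mem_points hℰ h a.1⟩
  else ⟨(ω₀, 1), ω₀.2⟩

/-! ### Measurability and functoriality of the head maps. -/

section

variable {ℰ : MarkedConfig G Ξ → G} (hℰ : ∀ ω, ω.points.Nonempty → ℰ ω ∈ ω.points)
  (ω₀ : RootedConfig G Ξ)

theorem headUnit_of_nonempty {ω : MarkedConfig G Ξ} (h : ω.points.Nonempty) :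
    headUnit ℰ hℰ ω₀ ω = reroot ω (ℰ ω) (hℰ ω h) := dif_pos h

theorem headUnit_of_not_nonempty {ω : MarkedConfig G Ξ} (h : ¬ ω.points.Nonempty) :
    headUnit ℰ hℰ ω₀ ω = ω₀ := dif_neg h

theorem headArrow_of_nonempty (g : G) {ω : MarkedConfig G Ξ} (h : ω.points.Nonempty) :
    headArrow ℰ hℰ ω₀ (g, ω) =
      ⟨(reroot ω (ℰ ω) (hℰ ω h), (ℰ ω)⁻¹ * g * ℰ (g⁻¹ • ω)), head_mem_points hℰ h g⟩ := dif_pos h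

theorem headArrow_of_not_nonempty (g : G) {ω : MarkedConfig G Ξ} (h : ¬ ω.points.Nonempty) :
    headArrow ℰ hℰ ω₀ (g, ω) = ⟨(ω₀, 1), ω₀.2⟩ := dif_neg h

theorem measurable_headUnit (hm : Measurable ℰ) : Measurable (headUnit ℰ hℰ ω₀) := by
  classical
  have h : Measurable fun ω => (headUnit ℰ hℰ ω₀ ω).1 := by
    have h' : (fun ω => (headUnit ℰ hℰ ω₀ ω).1) =
        fun ω => if ω.points.Nonempty then (ℰ ω)⁻¹ • ω else ω₀.1 := by
      funext ω
      by_cases h : ω.points.Nonempty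
      · rw [headUnit_of_nonempty hℰ ω₀ h, if_pos h]; rfl
      · rw [headUnit_of_not_nonempty hℰ ω₀ h, if_neg h]
    rw [h']
    exact Measurable.ite measurableSet_points_nonempty
      (MarkedConfig.measurable_smul' hm.inv measurable_id) measurable_const
  exact h.subtype_mk

theorem headArrow_fst (a : G × MarkedConfig G Ξ) :
    (headArrow ℰ hℰ ω₀ a).1.1 = headUnit ℰ hℰ ω₀ a.2 := by
  obtain ⟨g, ω⟩ := a
  by_cases h : ω.points.Nonempty
  · rw [headArrow_of_nonempty hℰ ω₀ g h, headUnit_of_nonempty hℰ ω₀ h]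
  · rw [headArrow_of_not_nonempty hℰ ω₀ g h, headUnit_of_not_nonempty hℰ ω₀ h]

theorem measurable_headArrow (hm : Measurable ℰ) : Measurable (headArrow ℰ hℰ ω₀) := by
  classical
  have h : Measurable fun a => (headArrow ℰ hℰ ω₀ a).1 := by
    refine Measurable.prodMk (f := fun a => (headArrow ℰ hℰ ω₀ a).1.1)
      (g := fun a => (headArrow ℰ hℰ ω₀ a).1.2) ?_ ?_
    · simp_rw [headArrow_fst]
      exact (measurable_headUnit hℰ ω₀ hm).comp measurable_snd
    · have h' : (fun a => (headArrow ℰ hℰ ω₀ a).1.2) =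
          fun a => if a.2.points.Nonempty then (ℰ a.2)⁻¹ * a.1 * ℰ (a.1⁻¹ • a.2) else 1 := by
        funext a
        obtain ⟨g, ω⟩ := a
        by_cases h : ω.points.Nonempty
        · rw [headArrow_of_nonempty hℰ ω₀ g h, if_pos h]
        · rw [headArrow_of_not_nonempty hℰ ω₀ g h, if_neg h]
      rw [h']
      exact Measurable.ite (measurable_snd measurableSet_points_nonempty)
        (((hm.comp measurable_snd).inv.mul measurable_fst).mul
          (hm.comp (MarkedConfig.measurable_smul' measurable_fst.inv measurable_snd)))
        measurable_const
  exact h.subtype_mk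

/-- The factor `(ℰ ω)⁻¹` cancels against the rerooting at the head. Emptiness is translation
invariant, so the constant value `ω₀` is consistent along orbits and no null set is discarded. -/
theorem reroot_headArrow (g : G) (ω : MarkedConfig G Ξ) :
    reroot (headArrow ℰ hℰ ω₀ (g, ω)).1.1.1 (headArrow ℰ hℰ ω₀ (g, ω)).1.2
      (headArrow ℰ hℰ ω₀ (g, ω)).2 = headUnit ℰ hℰ ω₀ (g⁻¹ • ω) := by
  apply Subtype.ext
  by_cases h : ω.points.Nonempty
  · have h' : (g⁻¹ • ω).points.Nonempty := (points_smul_nonempty_iff _ _).2 h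
    simp only [reroot, headArrow_of_nonempty hℰ ω₀ g h, headUnit_of_nonempty hℰ ω₀ h']
    simp [mul_smul]
  · have h' : ¬ (g⁻¹ • ω).points.Nonempty := fun hne => h ((points_smul_nonempty_iff _ _).1 hne)
    simp only [reroot, headArrow_of_not_nonempty hℰ ω₀ g h, headUnit_of_not_nonempty hℰ ω₀ h']
    simp

/-- The product telescopes: the head of `g⁻¹ • ω` ends the first factor and its inverse begins the
second. -/
theorem headArrow_mul_snd (g k : G) (ω : MarkedConfig G Ξ) :
    (headArrow ℰ hℰ ω₀ (g * k, ω)).1.2 =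
      (headArrow ℰ hℰ ω₀ (g, ω)).1.2 * (headArrow ℰ hℰ ω₀ (k, g⁻¹ • ω)).1.2 := by
  by_cases h : ω.points.Nonempty
  · have h' : (g⁻¹ • ω).points.Nonempty := (points_smul_nonempty_iff _ _).2 h
    rw [headArrow_of_nonempty hℰ ω₀ _ h, headArrow_of_nonempty hℰ ω₀ _ h,
      headArrow_of_nonempty hℰ ω₀ _ h']
    simp only [mul_inv_rev, mul_smul]
    group
  · have h' : ¬ (g⁻¹ • ω).points.Nonempty := fun hne => h ((points_smul_nonempty_iff _ _).1 hne)
    rw [headArrow_of_not_nonempty hℰ ω₀ _ h, headArrow_of_not_nonempty hℰ ω₀ _ h,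
      headArrow_of_not_nonempty hℰ ω₀ _ h', mul_one]

theorem headArrow_one_snd (ω : MarkedConfig G Ξ) : (headArrow ℰ hℰ ω₀ (1, ω)).1.2 = 1 := by
  by_cases h : ω.points.Nonempty
  · rw [headArrow_of_nonempty hℰ ω₀ _ h]
    simp
  · rw [headArrow_of_not_nonempty hℰ ω₀ _ h]

theorem headArrow_inv (lam : Measure G) (U : Set G) (μ : Measure (MarkedConfig G Ξ))
    (a : G × MarkedConfig G Ξ) :
    headArrow ℰ hℰ ω₀ ((actionGroupoid lam μ).inv a) =
      (palmGroupoid lam U μ).inv (headArrow ℰ hℰ ω₀ a) := by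
  obtain ⟨g, ω⟩ := a
  refine Subtype.ext (Prod.ext ?_ ?_)
  · exact (headArrow_fst hℰ ω₀ _).trans (reroot_headArrow hℰ ω₀ g ω).symm
  · change (headArrow ℰ hℰ ω₀ (g⁻¹, g⁻¹ • ω)).1.2 = (headArrow ℰ hℰ ω₀ (g, ω)).1.2⁻¹
    refine eq_inv_of_mul_eq_one_right ?_
    rw [← headArrow_mul_snd, mul_inv_cancel, headArrow_one_snd]

/-! ### Push-forwards of the unit and arrow measures. -/

variable {lam : Measure G} [lam.IsHaarMeasure] [lam.IsMulRightInvariant] {U : Set G}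
  {μ : Measure (MarkedConfig G Ξ)}

/-- The process seen from the head of a balanced head map has the Palm distribution. -/
theorem measure_head_smul_mem (hm : Measurable ℰ) (hU : MeasurableSet U) (hU_pos : lam U ≠ 0)
    (hU_fin : lam U ≠ ∞) (hμ : IsErgodicInvariant μ) (hμ_fin : intensity lam U μ ≠ ∞)
    (hne : ∀ᵐ ω ∂μ, ω.points.Nonempty)
    (hbal : ∀ᵐ ω ∂μ, ∀ x ∈ ω.points, lam {g | g * ℰ (g⁻¹ • ω) = x} = (intensity lam U μ)⁻¹)
    (hℰ : ∀ ω, ω.points.Nonempty → ℰ ω ∈ ω.points)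
    {B : Set (MarkedConfig G Ξ)} (hB : MeasurableSet B) :
    μ {ω | (ℰ ω)⁻¹ • ω ∈ B} = palmMeasure lam U μ (Subtype.val ⁻¹' B) := by
  have hprob := hμ.isProbabilityMeasure
  set A : Set (MarkedConfig G Ξ × G) :=
    {p | p.1.points.Nonempty ∧ ℰ p.1 = p.2 ∧ p.2⁻¹ • p.1 ∈ B}
  have hsmul : Measurable fun p : MarkedConfig G Ξ × G => p.2⁻¹ • p.1 :=
    MarkedConfig.measurable_smul' measurable_snd.inv measurable_fst
  have hA : IsSection A := by
    refine ⟨(measurable_fst measurableSet_points_nonempty).inter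
      ((measurableSet_eq_fun (hm.comp measurable_fst) measurable_snd).inter (hsmul hB)),
      fun ω x h => ?_, fun ω x y hx hy => hx.2.1.symm.trans hy.2.1⟩
    have h2 : ℰ ω = x := h.2.1
    exact h2 ▸ hℰ ω h.1
  have hmass := mass_transport lam hμ hU hA.measurableSet
  have hdom : μ (domain A) = μ {ω | (ℰ ω)⁻¹ • ω ∈ B} := by
    refine measure_congr ?_
    filter_upwards [hne] with ω hω
    refine propext ⟨?_, fun h => ⟨ℰ ω, hω, rfl, h⟩⟩
    rintro ⟨x, -, hx, hxB⟩
    have hx' : ℰ ω = x := hx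
    change (ℰ ω)⁻¹ • ω ∈ B
    rw [hx']
    exact hxB
  have hland : ∀ᵐ ω ∂μ, ∑' x : ↥(ω.points ∩ U), land lam A ω x.1 =
      (intensity lam U μ)⁻¹ * ((ω.points ∩ {g | g ∈ U ∧ g⁻¹ • ω ∈ B}).encard : ℝ≥0∞) := by
    filter_upwards [hne, hbal] with ω h1 h2
    rw [← tsum_points_const,
      tsum_subtype (ω.points ∩ U) (fun x => land lam A ω x),
      tsum_subtype (ω.points ∩ {g | g ∈ U ∧ g⁻¹ • ω ∈ B}) (fun _ => (intensity lam U μ)⁻¹)]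
    refine tsum_congr fun x => ?_
    by_cases hx : x ∈ ω.points ∩ U
    -- Rerooting g⁻¹ω at g⁻¹x gives x⁻¹ω for every g, so `x` keeps its whole cell or none of it,
    -- according to whether x⁻¹ω lies in `B`.
    · have hset : ∀ g : G, (g⁻¹ • ω, g⁻¹ * x) ∈ A ↔ g * ℰ (g⁻¹ • ω) = x ∧ x⁻¹ • ω ∈ B := by
        intro g
        have hg : (g⁻¹ * x)⁻¹ • g⁻¹ • ω = x⁻¹ • ω := by simp [← mul_smul]
        simp only [A, mem_ofPred_eq, hg, points_smul_nonempty_iff, h1, true_and,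
          eq_inv_mul_iff_mul_eq]
      rw [indicator_of_mem hx, land]
      simp only [hset]
      by_cases hxB : x⁻¹ • ω ∈ B
      · rw [indicator_of_mem (show x ∈ ω.points ∩ {g | g ∈ U ∧ g⁻¹ • ω ∈ B} from
          ⟨hx.1, hx.2, hxB⟩)]
        simp only [hxB, and_true]
        exact h2 x hx.1
      · rw [indicator_of_notMem fun h => hxB h.2.2]
        simp [hxB]
    · rw [indicator_of_notMem hx, indicator_of_notMem fun h => hx ⟨h.1, h.2.1⟩]
  have hmeas : Measurable fun ω : MarkedConfig G Ξ =>
      ((ω.points ∩ {g | g ∈ U ∧ g⁻¹ • ω ∈ B}).encard : ℝ≥0∞) :=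
    measurable_encard_fiber (A := {p | p.2 ∈ U ∧ p.2⁻¹ • p.1 ∈ B})
      ((measurable_snd hU).inter (hsmul hB))
  rw [lintegral_congr_ae hland, lintegral_const_mul _ hmeas, hA.lintegral_encard_fiber,
    hdom] at hmass
  rw [palmMeasure_apply lam hU μ hB, ENNReal.mul_inv (Or.inr hU_fin) (Or.inl hμ_fin),
    mul_comm (_⁻¹), mul_assoc, hmass, ← mul_assoc, ENNReal.inv_mul_cancel hU_pos hU_fin, one_mul]

/-- The factor map of a balanced head map pushes the unit measure to the Palm measure. -/
theorem map_headUnit (hm : Measurable ℰ) (hU : MeasurableSet U) (hU_pos : lam U ≠ 0)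
    (hU_fin : lam U ≠ ∞) (hμ : IsErgodicInvariant μ) (hμ_fin : intensity lam U μ ≠ ∞)
    (hne : ∀ᵐ ω ∂μ, ω.points.Nonempty)
    (hbal : ∀ᵐ ω ∂μ, ∀ x ∈ ω.points, lam {g | g * ℰ (g⁻¹ • ω) = x} = (intensity lam U μ)⁻¹) :
    μ.map (headUnit ℰ hℰ ω₀) = palmMeasure lam U μ := by
  refine Measure.ext fun S hS => ?_
  rw [Measure.map_apply (measurable_headUnit hℰ ω₀ hm) hS]
  obtain ⟨B, hB, rfl⟩ := hS
  rw [← measure_head_smul_mem hm hU hU_pos hU_fin hμ hμ_fin hne hbal hℰ hB]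
  refine measure_congr ?_
  filter_upwards [hne] with ω hω
  change ((headUnit ℰ hℰ ω₀ ω).1 ∈ B) = ((ℰ ω)⁻¹ • ω ∈ B)
  rw [headUnit_of_nonempty hℰ ω₀ hω]
  rfl

/-- The factor map of a balanced head map pushes the arrow measure to a multiple of the arrow
measure of the Palm groupoid. -/
theorem map_headArrow (hm : Measurable ℰ) (hU : MeasurableSet U) (hU_pos : lam U ≠ 0)
    (hU_fin : lam U ≠ ∞) (hμ : IsErgodicInvariant μ) (hμ_fin : intensity lam U μ ≠ ∞)
    (hne : ∀ᵐ ω ∂μ, ω.points.Nonempty)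
    (hbal : ∀ᵐ ω ∂μ, ∀ x ∈ ω.points, lam {g | g * ℰ (g⁻¹ • ω) = x} = (intensity lam U μ)⁻¹) :
    (lam.prod μ).map (headArrow ℰ hℰ ω₀) =
      (intensity lam U μ)⁻¹ • palmArrowMeasure lam U μ := by
  have hprob := hμ.isProbabilityMeasure
  refine Measure.ext fun S hS => ?_
  have hφ := measurable_headArrow hℰ ω₀ hm
  rw [Measure.map_apply hφ hS, Measure.prod_apply_symm (hφ hS)]
  obtain ⟨D, hD, rfl⟩ := hS
  have hmeas : Measurable fun ω : RootedConfig G Ξ =>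
      ((ω.1.points ∩ {g | (ω, g) ∈ D}).encard : ℝ≥0∞) :=
    MarkedConfig.measurable_encard_points (f := fun ω : RootedConfig G Ξ => ω.1)
      measurable_subtype_coe hD
  rw [Measure.smul_apply, palmArrowMeasure_apply lam U μ hD,
    ← map_headUnit hℰ ω₀ hm hU hU_pos hU_fin hμ hμ_fin hne hbal,
    lintegral_map hmeas (measurable_headUnit hℰ ω₀ hm), smul_eq_mul]
  refine Eq.trans ?_ (lintegral_const_mul _ (hmeas.comp (measurable_headUnit hℰ ω₀ hm)))
  refine lintegral_congr_ae ?_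
  filter_upwards [hne, hbal] with ω h1 h2
  set P : Set G := ω.points ∩ {x | (headUnit ℰ hℰ ω₀ ω, (ℰ ω)⁻¹ * x) ∈ D}
  have hP : P.Countable := ω.countable_points.mono inter_subset_left
  have hcell : ∀ x, MeasurableSet {g : G | g * ℰ (g⁻¹ • ω) = x} := fun x =>
    measurableSet_eq_fun (measurable_id.mul
      (hm.comp (MarkedConfig.measurable_smul' measurable_inv measurable_const))) measurable_const
  -- The image of (g, ω) depends on g only through its owner, so the preimage is a disjoint union of
  -- cells, all of the same measure.
  have hset : (fun g : G => (g, ω)) ⁻¹' (headArrow ℰ hℰ ω₀ ⁻¹' (Subtype.val ⁻¹' D)) =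
      ⋃ x ∈ P, {g : G | g * ℰ (g⁻¹ • ω) = x} := by
    ext g
    have hg : g * ℰ (g⁻¹ • ω) ∈ ω.points :=
      MarkedConfig.mul_mem_points (hℰ (g⁻¹ • ω) ((points_smul_nonempty_iff _ _).2 h1))
    simp only [mem_preimage, mem_iUnion, mem_ofPred_eq, exists_prop, exists_eq_right',
      headArrow_of_nonempty hℰ ω₀ g h1]
    simp only [P, mem_inter_iff, hg, true_and, mem_ofPred_eq, headUnit_of_nonempty hℰ ω₀ h1,
      mul_assoc]
  have hPcard : (headUnit ℰ hℰ ω₀ ω).1.points ∩ {g | (headUnit ℰ hℰ ω₀ ω, g) ∈ D} =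
      (fun x => (ℰ ω)⁻¹ * x) '' P := by
    have hpts : ∀ y, y ∈ (headUnit ℰ hℰ ω₀ ω).1.points ↔ ℰ ω * y ∈ ω.points := fun y => by
      rw [headUnit_of_nonempty hℰ ω₀ h1]
      exact (MarkedConfig.mem_smul_points _ _ _).trans (by rw [inv_inv])
    ext y
    constructor
    · rintro ⟨hy, hyD⟩
      refine ⟨ℰ ω * y, ⟨(hpts y).1 hy, ?_⟩, inv_mul_cancel_left _ _⟩
      change (_, (ℰ ω)⁻¹ * (ℰ ω * y)) ∈ D
      rwa [inv_mul_cancel_left]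
    · rintro ⟨x, ⟨hx, hxD⟩, rfl⟩
      exact ⟨(hpts _).2 (by simpa using hx), hxD⟩
  rw [hset, measure_biUnion hP ?_ fun x _ => hcell x, hPcard,
    (mul_right_injective _).encard_image]
  · rw [tsum_congr fun x : P => h2 x.1 x.2.1]
    exact tsum_points_const ω _ _
  · intro x _ y _ hxy
    exact disjoint_left.2 fun g hgx hgy => hxy ((Eq.symm hgx).trans hgy)

theorem isFactorMap_head (hm : Measurable ℰ) (hU : MeasurableSet U) (hU_pos : lam U ≠ 0)
    (hU_fin : lam U ≠ ∞) (hμ : IsErgodicInvariant μ) (hμ_pos : intensity lam U μ ≠ 0)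
    (hμ_fin : intensity lam U μ ≠ ∞) (hne : ∀ᵐ ω ∂μ, ω.points.Nonempty)
    (hbal : ∀ᵐ ω ∂μ, ∀ x ∈ ω.points, lam {g | g * ℰ (g⁻¹ • ω) = x} = (intensity lam U μ)⁻¹) :
    (actionGroupoid lam μ).IsFactorMap (palmGroupoid lam U μ)
      (headUnit ℰ hℰ ω₀) (headArrow ℰ hℰ ω₀) where
  measurable_unit := measurable_headUnit hℰ ω₀ hm
  measurable_arrow := measurable_headArrow hℰ ω₀ hm
  map_src := headArrow_fst hℰ ω₀
  map_tgt a := reroot_headArrow hℰ ω₀ a.1 a.2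
  map_comp := by
    rintro ⟨g, ω⟩ ⟨k, ω'⟩ h h'
    obtain rfl : g⁻¹ • ω = ω' := h
    refine Subtype.ext (Prod.ext ?_ (headArrow_mul_snd hℰ ω₀ g k ω))
    exact (headArrow_fst hℰ ω₀ _).trans (headArrow_fst hℰ ω₀ (g, ω)).symm
  map_unitMeasure := map_headUnit hℰ ω₀ hm hU hU_pos hU_fin hμ hμ_fin hne hbal
  map_arrowMeasure := ⟨(intensity lam U μ)⁻¹, ENNReal.inv_ne_zero.2 hμ_fin,
    ENNReal.inv_ne_top.2 hμ_pos, map_headArrow hℰ ω₀ hm hU hU_pos hU_fin hμ hμ_fin hne hbal⟩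

/-- Invariance under inversion passes from the action groupoid to its factor. -/
theorem isPMP_palmGroupoid (hm : Measurable ℰ) (hU : MeasurableSet U) (hU_pos : lam U ≠ 0)
    (hU_fin : lam U ≠ ∞) (hμ : IsErgodicInvariant μ) (hμ_pos : intensity lam U μ ≠ 0)
    (hμ_fin : intensity lam U μ ≠ ∞) (hne : ∀ᵐ ω ∂μ, ω.points.Nonempty)
    (hbal : ∀ᵐ ω ∂μ, ∀ x ∈ ω.points, lam {g | g * ℰ (g⁻¹ • ω) = x} = (intensity lam U μ)⁻¹)
    (hℰ : ∀ ω, ω.points.Nonempty → ℰ ω ∈ ω.points) (ω₀ : RootedConfig G Ξ) :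
    (palmGroupoid lam U μ).IsPMP := by
  have hprob := hμ.isProbabilityMeasure
  have hφ := measurable_headArrow hℰ ω₀ hm
  have hinvm := (palmGroupoid lam U μ).measurable_inv
  refine ⟨?_, ?_⟩
  · change IsProbabilityMeasure (palmMeasure lam U μ)
    rw [← map_headUnit hℰ ω₀ hm hU hU_pos hU_fin hμ hμ_fin hne hbal]
    exact Measure.isProbabilityMeasure_map (measurable_headUnit hℰ ω₀ hm).aemeasurable
  · set c := (intensity lam U μ)⁻¹
    have hc0 : c ≠ 0 := ENNReal.inv_ne_zero.2 hμ_fin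
    have hc1 : c ≠ ∞ := ENNReal.inv_ne_top.2 hμ_pos
    have harr := map_headArrow hℰ ω₀ hm hU hU_pos hU_fin hμ hμ_fin hne hbal
    have hact : (lam.prod μ).map (actionGroupoid lam μ).inv = lam.prod μ :=
      (isPMP_actionGroupoid lam hμ).2
    have hcomp : (palmGroupoid lam U μ).inv ∘ headArrow ℰ hℰ ω₀ =
        headArrow ℰ hℰ ω₀ ∘ (actionGroupoid lam μ).inv :=
      funext fun a => (headArrow_inv hℰ ω₀ lam U μ a).symm
    -- The arrow map intertwines the inversions, so invariance descends up to the factor `c`, which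
    -- is positive and finite and cancels.
    have h : c • (palmArrowMeasure lam U μ).map (palmGroupoid lam U μ).inv =
        c • palmArrowMeasure lam U μ := by
      rw [← Measure.map_smul, ← harr, Measure.map_map hinvm hφ, hcomp,
        ← Measure.map_map hφ (actionGroupoid lam μ).measurable_inv, hact]
    change (palmArrowMeasure lam U μ).map (palmGroupoid lam U μ).inv = palmArrowMeasure lam U μ
    refine Measure.ext fun S _ => ?_
    have hS := congrArg (fun ν : Measure _ => ν S) h
    simp only [Measure.smul_apply, smul_eq_mul] at hS
    exact (ENNReal.mul_right_inj hc0 hc1).1 hS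

end

/-! ## The allocation of a head map -/

open Classical in
/-- The allocation under which the site `g` belongs to the head of `g⁻¹ • ω`, translated back. -/
def headAllocation (ℰ : MarkedConfig G Ξ → G) (ω : MarkedConfig G Ξ) (g : G) : Option G :=
  if ω.points.Nonempty then some (g * ℰ (g⁻¹ • ω)) else none

theorem headAllocation_eq_some_iff {ℰ : MarkedConfig G Ξ → G} {ω : MarkedConfig G Ξ} {g x : G} :
    headAllocation ℰ ω g = some x ↔ ω.points.Nonempty ∧ g * ℰ (g⁻¹ • ω) = x := by
  unfold headAllocation
  split_ifs with h <;> simp [h]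

theorem isPartialAllocation_headAllocation {ℰ : MarkedConfig G Ξ → G} (hm : Measurable ℰ)
    (hℰ : ∀ ω, ω.points.Nonempty → ℰ ω ∈ ω.points) :
    IsPartialAllocation (headAllocation ℰ) where
  measurable S hS := by
    have h : MeasurableSet {p : MarkedConfig G Ξ × G |
        p.1.points.Nonempty ∧ p.2 * ℰ (p.2⁻¹ • p.1) ∈ S} :=
      (measurable_fst measurableSet_points_nonempty).inter ((measurable_snd.mul (hm.comp
        (MarkedConfig.measurable_smul' measurable_snd.inv measurable_fst))) hS)
    convert h using 1
    ext p
    simp only [headAllocation_eq_some_iff, mem_ofPred_eq]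
    exact ⟨fun ⟨x, hx, h1, h2⟩ => ⟨h1, h2 ▸ hx⟩, fun ⟨h1, h2⟩ => ⟨_, h2, h1, rfl⟩⟩
  equivariant h ω g := by
    by_cases hω : ω.points.Nonempty
    · rw [headAllocation, headAllocation, if_pos hω, if_pos ((points_smul_nonempty_iff h ω).2 hω)]
      simp [mul_smul, mul_assoc]
    · rw [headAllocation, headAllocation, if_neg hω,
        if_neg fun hh => hω ((points_smul_nonempty_iff h ω).1 hh)]
      rfl
  mem_points ω g x h := by
    obtain ⟨h1, rfl⟩ := headAllocation_eq_some_iff.1 h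
    exact MarkedConfig.mul_mem_points (hℰ (g⁻¹ • ω) ((points_smul_nonempty_iff _ _).2 h1))

end FactorMap

end PointProcess

/-! ### Assembly of the main theorem. -/

theorem mainTheorem9 {G : Type*} {Ξ : Type*}
    [Group G] [TopologicalSpace G] [IsTopologicalGroup G] [T2Space G] [LocallyCompactSpace G]
    [SecondCountableTopology G] [MeasurableSpace G] [BorelSpace G]
    [MeasurableSpace Ξ] [StandardBorelSpace Ξ]
    (hG : ¬ DiscreteTopology G)
    (lam : Measure G) [lam.IsHaarMeasure] [lam.IsMulRightInvariant]
    (U : Set G) (hU : MeasurableSet U) (hU_pos : lam U ≠ 0) (hU_fin : lam U ≠ ∞)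
    (μ : Measure (PointProcess.MarkedConfig G Ξ))
    (hμ : PointProcess.IsErgodicInvariant μ)
    (hμ_pos : PointProcess.intensity lam U μ ≠ 0)
    (hμ_fin : PointProcess.intensity lam U μ ≠ ∞) :
    (PointProcess.actionGroupoid lam μ).IsPMP ∧
    (PointProcess.palmGroupoid lam U μ).IsPMP ∧
    ∃ (𝒜 : PointProcess.MarkedConfig G Ξ → G → Option G)
      (ℰ : PointProcess.MarkedConfig G Ξ → G)
      (φ₀ : PointProcess.MarkedConfig G Ξ → PointProcess.RootedConfig G Ξ)
      (φ : G × PointProcess.MarkedConfig G Ξ → PointProcess.BirootedConfig G Ξ),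
      PointProcess.IsBalancedAllocation lam U μ 𝒜 ∧
      PointProcess.IsExtraHeadScheme lam U μ ℰ ∧
      (∀ᵐ ω ∂μ, 𝒜 ω 1 = some (ℰ ω)) ∧
      (PointProcess.actionGroupoid lam μ).IsFactorMap
        (PointProcess.palmGroupoid lam U μ) φ₀ φ ∧
      (∀ᵐ ω ∂μ, (φ₀ ω).1 = (ℰ ω)⁻¹ • ω ∧
        ∀ g : G, (φ (g, ω)).1.1 = φ₀ ω ∧ (φ (g, ω)).1.2 = (ℰ ω)⁻¹ * g * ℰ (g⁻¹ • ω)) ∧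
      ∀ (Γ : Type*) [Group Γ] [MeasurableSpace Γ] [DiscreteMeasurableSpace Γ]
        (c : PointProcess.BirootedConfig G Ξ → Γ),
        (PointProcess.palmGroupoid lam U μ).IsCocycle c →
          (PointProcess.actionGroupoid lam μ).IsCocycle (fun a => c (φ a)) := by
  have hnebot : Filter.NeBot (nhdsWithin (1 : G) {1}ᶜ) := by
    refine ⟨fun h => hG (discreteTopology_of_isOpen_singleton_one ?_)⟩
    exact (isOpen_singleton_iff_punctured_nhds 1).2 h
  have hprob := hμ.isProbabilityMeasure
  obtain ⟨ℰ, hm, hℰ, hne, hbal⟩ :=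
    PointProcess.exists_head_map lam hU hU_pos hU_fin hμ hμ_pos hμ_fin
  obtain ⟨ω₁, hω₁⟩ := hne.exists
  -- Any rooted configuration serves as the value over the empty configuration; one exists because
  -- the process is almost surely nonempty.
  have ω₀ : PointProcess.RootedConfig G Ξ := PointProcess.reroot ω₁ (ℰ ω₁) (hℰ ω₁ hω₁)
  have hfac := PointProcess.isFactorMap_head hℰ ω₀ hm hU hU_pos hU_fin hμ hμ_pos hμ_fin hne hbal
  refine ⟨PointProcess.isPMP_actionGroupoid lam hμ,
    PointProcess.isPMP_palmGroupoid hm hU hU_pos hU_fin hμ hμ_pos hμ_fin hne hbal hℰ ω₀,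
    PointProcess.headAllocation ℰ, ℰ, PointProcess.headUnit ℰ hℰ ω₀,
    PointProcess.headArrow ℰ hℰ ω₀,
    ⟨PointProcess.isPartialAllocation_headAllocation hm hℰ, ?_⟩, ⟨hm, ?_, ?_⟩, ?_, hfac, ?_, ?_⟩
  · filter_upwards [hne, hbal] with ω h1 h2 x hx
    simp only [PointProcess.cell, PointProcess.headAllocation_eq_some_iff, h1, true_and]
    exact h2 x hx
  · filter_upwards [hne] with ω h1 using hℰ ω h1
  · refine Measure.ext fun B hB => ?_
    refine (Measure.map_apply
      (PointProcess.MarkedConfig.measurable_smul' hm.inv measurable_id) hB).trans ?_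
    rw [Measure.map_apply measurable_subtype_coe hB]
    exact PointProcess.measure_head_smul_mem hm hU hU_pos hU_fin hμ hμ_fin hne hbal hℰ hB
  · filter_upwards [hne] with ω h1
    exact PointProcess.headAllocation_eq_some_iff.2 ⟨h1, by simp⟩
  · filter_upwards [hne] with ω h1
    refine ⟨?_, fun g => ⟨PointProcess.headArrow_fst hℰ ω₀ (g, ω), ?_⟩⟩
    · rw [PointProcess.headUnit_of_nonempty hℰ ω₀ h1]
      rfl
    · rw [PointProcess.headArrow_of_nonempty hℰ ω₀ g h1]
  · intro Γ _ _ _ c hc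
    refine ⟨hc.measurable.comp hfac.measurable_arrow, fun a b h => ?_⟩
    have h' : (PointProcess.palmGroupoid lam U μ).tgt (PointProcess.headArrow ℰ hℰ ω₀ a) =
        (PointProcess.palmGroupoid lam U μ).src (PointProcess.headArrow ℰ hℰ ω₀ b) := by
      rw [hfac.map_tgt, hfac.map_src, h]
    rw [hfac.map_comp a b h h', hc.map_comp _ _ h']
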